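/- Let $a,b,c,d\in\mathbb R$ and $\mu\ge 0$ satisfy (i) $a\in[\eta^{-1},\eta]\setminus\{1\}$, where $\eta=\frac{\sqrt3+1}{\sqrt3-1}$; (ii) $\left|\frac{bd}{c}\right|\le 1$; (iii) $c\ge \frac{\pi^2}{8}$; (iv) $1+2(\sinh\mu+2\cosh\mu)\,b^2\le c$ and $\mu\le\mu^\ast:=\ln\left(\frac{|1+a|}{\sqrt2\,|1-a|}\right)$; (v) $|d|\le 2\sqrt{\mu e^{-\mu}}$. For $\varepsilon>0$ consider the system $$\begin{cases}u_{tt}=u_{xx}, & (x,t)\in(0,1)\times(0,\infty),\\ u(0,t)=0,\quad u_x(1,t)=-a\,u_t(1,t)+b\,p(0,t), & t>0,\\ \varepsilon p_t=p_{xx}, & (x,t)\in(0,1)\times(0,\infty),\\ p_x(0,t)=c\,p(0,t),\quad p_x(1,t)=d\,u(1,t), & t>0,\\ u(\cdot,0)=u_0,\ u_t(\cdot,0)=u_1,\ p(\cdot,0)=p_0.\end{cases}$$ It is written as $\dot Y=A_\varepsilon Y$, $Y(0)=Y_0=(u_0,u_1,p_0)$, for $Y=(u,u_t,p)$, with $A_\varepsilon(u,v,p)=(v,u_{xx},\varepsilon^{-1}p_{xx})$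 on the domain $D(A_\varepsilon)$ of all $(u,v,p)\in H^2(0,1)\times H^1(0,1)\times H^2(0,1)$ with $u(0)=v(0)=0$, $u_x(1)=-av(1)+bp(0)$, $p_x(0)=cp(0)$, $p_x(1)=du(1)$. A mild solution is a function $Y\in C([0,\infty);H^1(0,1)\times L^2(0,1)\times L^2(0,1))$ such that, for all $t\ge0$, $\int_0^tY(s)\,ds\in D(A_\varepsilon)$ and $Y(t)=Y_0+A_\varepsilon\int_0^tY(s)\,ds$. Then for every $\varepsilon>0$ and every $(u_0,u_1,p_0)\in H^1(0,1)\times L^2(0,1)\times L^2(0,1)$ with $u_0(0)=0$ the system has a unique mild solution. If moreover $c\ge\frac{\pi^2}{4}$ and $|d|\le\sqrt{\mu e^{-\mu}}$, then for every $\varepsilon>0$ the origin is exponentially stable in $H^1(0,1)\times L^2(0,1)\times L^2(0,1)$; more precisely, there is $\kappa>0$ independent of $\varepsilon$ such that for every $\varepsilon>0$ there is $C>0$ for which every mild solution with an initial datum as above satisfies $$\|Y(t)\|_{H^1\times L^2\times L^2}\le C\,e^{-\kappa\min\{1,1/\varepsilon\}\,t}\,\|Y_0\|_{H^1\times L^2\times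 L^2}\qquad\text{for all } t\ge0.$$ In particular the rate can be chosen independently of $\varepsilon\in(0,1]$. -/

import Mathlib

open MeasureTheory Set
open scoped ContDiff

noncomputable section

namespace WaveHeat

/-- `L²(0,1)`, real valued. -/
abbrev L2 : Type := Lp ℝ 2 (volume.restrict (Ioo (0 : ℝ) 1))

/-- `φ ∈ C_c^∞(0,1)`. -/
structure IsTest (φ : ℝ → ℝ) : Prop where
  smooth : ContDiff ℝ ∞ φ
  compact : HasCompactSupport φ
  supp : tsupport φ ⊆ Ioo 0 1

/-- `g ∈ L²(0,1)` is the weak derivative of `f ∈ L²(0,1)` on `(0,1)`. -/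
def HasWeakDeriv (f g : L2) : Prop :=
  ∀ φ : ℝ → ℝ, IsTest φ →
    ∫ x in Ioo (0 : ℝ) 1, f x * deriv φ x = -∫ x in Ioo (0 : ℝ) 1, g x * φ x

theorem exists_inner_eq {ψ : ℝ → ℝ} (hc : Continuous ψ) (hs : HasCompactSupport ψ) :
    ∃ ψ' : L2, ∀ f : L2, ∫ x in Ioo (0 : ℝ) 1, f x * ψ x = inner ℝ ψ' f := by
  have hm : MemLp ψ 2 (volume.restrict (Ioo (0 : ℝ) 1)) :=
    (hc.memLp_of_hasCompactSupport (p := 2) (μ := volume) hs).restrict _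
  refine ⟨hm.toLp ψ, fun f => ?_⟩
  rw [L2.inner_def]
  refine integral_congr_ae ?_
  filter_upwards [hm.coeFn_toLp] with x hx
  simp [hx]

theorem hasWeakDeriv_iff_inner :
    ∀ φ : ℝ → ℝ, IsTest φ → ∃ α β : L2, ∀ f g : L2,
      (∫ x in Ioo (0 : ℝ) 1, f x * deriv φ x = -∫ x in Ioo (0 : ℝ) 1, g x * φ x) ↔
        inner ℝ α f + inner ℝ β g = (0 : ℝ) := by
  intro φ hφ
  obtain ⟨α, hα⟩ := exists_inner_eq (hφ.smooth.continuous_deriv (by simp)) hφ.compact.deriv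
  obtain ⟨β, hβ⟩ := exists_inner_eq hφ.smooth.continuous hφ.compact
  refine ⟨α, β, fun f g => ?_⟩
  rw [hα, hβ]
  exact eq_neg_iff_add_eq_zero

/-- `H¹(0,1)`: the pairs `(u, u_x)` in `L² × L²` with `u_x` the weak derivative of `u`. The norm
inherited from the Hilbert product is `(‖u‖² + ‖u_x‖²)^{1/2}`. -/
def H1 : Submodule ℝ (WithLp 2 (L2 × L2)) where
  carrier := {w | HasWeakDeriv w.fst w.snd}
  zero_mem' := by
    intro φ hφ
    obtain ⟨α, β, h⟩ := hasWeakDeriv_iff_inner φ hφ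
    exact (h _ _).2 (by simp)
  add_mem' := by
    intro v w hv hw φ hφ
    obtain ⟨α, β, h⟩ := hasWeakDeriv_iff_inner φ hφ
    have h1 := (h _ _).1 (hv φ hφ)
    have h2 := (h _ _).1 (hw φ hφ)
    refine (h _ _).2 ?_
    simp only [WithLp.add_fst, WithLp.add_snd, inner_add_right]
    linarith
  smul_mem' := by
    intro r v hv φ hφ
    obtain ⟨α, β, h⟩ := hasWeakDeriv_iff_inner φ hφ
    have h1 := (h _ _).1 (hv φ hφ)
    refine (h _ _).2 ?_
    simp only [WithLp.smul_fst, WithLp.smul_snd, inner_smul_right]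
    rw [← mul_add, h1, mul_zero]

/-- `H¹(0,1)` is a Hilbert space. -/
instance : CompleteSpace H1 := by
  have hcl : IsClosed (H1 : Set (WithLp 2 (L2 × L2))) := by
    have : (H1 : Set (WithLp 2 (L2 × L2))) =
        ⋂ φ : {φ : ℝ → ℝ // IsTest φ}, {w | ∫ x in Ioo (0 : ℝ) 1, w.fst x * deriv φ.1 x
          = -∫ x in Ioo (0 : ℝ) 1, w.snd x * φ.1 x} := by
      ext w
      simp only [mem_iInter, mem_ofPred_eq, Subtype.forall]
      rfl
    rw [this]
    refine isClosed_iInter fun φ => ?_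
    obtain ⟨α, β, h⟩ := hasWeakDeriv_iff_inner φ.1 φ.2
    simp only [h]
    exact isClosed_eq (by fun_prop) continuous_const
  exact hcl.completeSpace_coe

/-- The function `f ∈ L²(0,1)` has a representative continuous on `[0,1]`, and its value at `x`
is `y`. For `f ∈ H¹(0,1)` and `x ∈ {0, 1}` this says that the trace of `f` at `x` is `y`. -/
def HasTrace (f : L2) (x y : ℝ) : Prop :=
  ∃ F : ℝ → ℝ, ContinuousOn F (Icc 0 1) ∧
    (∀ᵐ s ∂(volume.restrict (Ioo (0 : ℝ) 1)), f s = F s) ∧ F x = y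

/-- The state space `H¹(0,1) × L²(0,1) × L²(0,1)` with its Hilbert product norm. -/
abbrev State : Type := WithLp 2 (H1 × WithLp 2 (L2 × L2))

/-- Displacement component `u ∈ H¹(0,1)`, as an `L²` function. -/
def State.u (Y : State) : L2 := Y.fst.1.fst

/-- The weak derivative `u_x` of the displacement component. -/
def State.ux (Y : State) : L2 := Y.fst.1.snd

/-- Velocity component `v = u_t`. -/
def State.v (Y : State) : L2 := Y.snd.fst

/-- Temperature component `p`. -/
def State.p (Y : State) : L2 := Y.snd.snd

/-- `Y = (u, v, p)` belongs to the domain of the operator `A_ε (u, v, p) = (v, u_xx, ε⁻¹ p_xx)`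
and `A_ε Y = Z`: one has `u ∈ H²`, `v ∈ H¹`, `p ∈ H²`, the boundary conditions
`u(0) = v(0) = 0`, `u_x(1) = -a v(1) + b p(0)`, `p_x(0) = c p(0)`, `p_x(1) = d u(1)`,
and `Z = (v, u_xx, ε⁻¹ p_xx)`. -/
def IsGenerator (a b c d ε : ℝ) (Y Z : State) : Prop :=
  ∃ uxx px pxx : L2,
    HasWeakDeriv Y.ux uxx ∧ HasWeakDeriv Y.p px ∧ HasWeakDeriv px pxx ∧
    Z.u = Y.v ∧ Z.v = uxx ∧ Z.p = ε⁻¹ • pxx ∧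
    ∃ u1 ux1 v1 p0 px0 px1 : ℝ,
      HasTrace Y.u 1 u1 ∧ HasTrace Y.ux 1 ux1 ∧ HasTrace Y.v 1 v1 ∧
      HasTrace Y.p 0 p0 ∧ HasTrace px 0 px0 ∧ HasTrace px 1 px1 ∧
      HasTrace Y.u 0 0 ∧ HasTrace Y.v 0 0 ∧
      ux1 = -a * v1 + b * p0 ∧ px0 = c * p0 ∧ px1 = d * u1

/-- `Y = (u, u_t, p) ∈ C([0,∞); H¹ × L² × L²)` is a mild solution, with initial datum `Y₀`, of
`Y' = A_ε Y`, that is, of the system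
`u_tt = u_xx`, `u(0,t) = 0`, `u_x(1,t) = -a u_t(1,t) + b p(0,t)`,
`ε p_t = p_xx`, `p_x(0,t) = c p(0,t)`, `p_x(1,t) = d u(1,t)`:
for all `t ≥ 0`, `∫₀ᵗ Y(s) ds ∈ D(A_ε)` and `Y(t) = Y₀ + A_ε ∫₀ᵗ Y(s) ds`. -/
def IsMildSolution (a b c d ε : ℝ) (Y₀ : State) (Y : ℝ → State) : Prop :=
  ContinuousOn Y (Ici 0) ∧
    ∀ t : ℝ, 0 ≤ t → IsGenerator a b c d ε (∫ s in (0 : ℝ)..t, Y s) (Y t - Y₀)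

end WaveHeat

end

/-! The proof is a Lyapunov argument made rigorous by semigroup theory. For the wave part, pass to
the Riemann invariants w = v + u_x and z = v - u_x, which are transported in opposite directions,
and use the squared norm N + lε‖p‖², where N = ∫ (e^{mx} w² + e^{-mx} z²). Along A_ε its derivative
is e^m w(1)² - e^{-m} z(1)² - mN + 2l(d p(1)u(1) - c p(0)² - ‖p_x‖²): the terms at x = 0 cancel
because v(0) = 0, and the factor ε cancels ε⁻¹, so the right side does not contain ε
(`IsGenerator.energy`). The condition at x = 1 reads (1+a)w = (1-a)z + 2b p(0); when 2e^{2m}(1-a)² ≤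
(1+a)², the boundary energy is at most a multiple K of p(0)² (`boundary_energy_le`).

For well-posedness take m = 0 and l large: the p(0)² terms are absorbed and the coupling d p(1)u(1)
costs only a multiple of the energy, so A_ε is quasi-dissipative (`exists_quasiDissipative`). For
stability take m = μ, l = 1 if μ > 0; if μ = 0 then d = 0, the equations decouple in one direction,
and a small fixed m with a large l works (`exists_dissipative`). The dissipation controls N + l‖p‖²
whereas the norm contains lε‖p‖², hence the factor min(1, 1/ε) in the rate.

The passage from these inequalities to mild solutions is a Hille–Yosida theorem for linear relations
in a Hilbert space (`QuasiDissipative.exists_isMild`), transported to the phase space u(0) = 0,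
where the weighted Riemann norm is equivalent to the given one (`exists_norm_le_riemann`). The range
condition is checked by solving the resolvent equations with hyperbolic functions; |bd| ≤ c makes
the remaining 2×2 determinant nonzero (`exists_isGenerator_resolvent`). Since mild solutions are
unique, the bound for the constructed one holds for all. -/

noncomputable section

namespace WaveHeat

open Filter Topology

/-! ### Hille–Yosida theory for quasi-dissipative linear relations. -/

section Abstract

variable {H : Type*} [NormedAddCommGroup H] [InnerProductSpace ℝ H]

/-- Mild solutions of `y' ∈ G y`, `y 0 = x₀`, for a linear relation `G`. -/
def IsMild {E : Type*} [NormedAddCommGroup E] [NormedSpace ℝ E] (G : Submodule ℝ (E × E))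
    (x₀ : E) (y : ℝ → E) : Prop :=
  ContinuousOn y (Ici 0) ∧ ∀ t, 0 ≤ t → (∫ s in (0 : ℝ)..t, y s, y t - x₀) ∈ G

/-- `⟪y, x⟫ ≤ γ ‖x‖²` on the graph `G`. -/
def QuasiDissipative (G : Submodule ℝ (H × H)) (γ : ℝ) : Prop :=
  ∀ x y, (x, y) ∈ G → inner ℝ y x ≤ γ * ‖x‖ ^ 2

/-- The function e^{-2γt}‖y‖² has nonpositive derivative. No sign of γ is assumed, so the same
estimate yields growth bounds and decay. -/
theorem norm_le_exp_of_hasDerivAt {γ T : ℝ} {y y' : ℝ → H}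
    (hc : ContinuousOn y (Icc 0 T))
    (hd : ∀ t ∈ Ioo 0 T, HasDerivAt y (y' t) t)
    (hi : ∀ t ∈ Ioo 0 T, inner ℝ (y' t) (y t) ≤ γ * ‖y t‖ ^ 2) {t : ℝ} (ht : t ∈ Icc 0 T) :
    ‖y t‖ ≤ Real.exp (γ * t) * ‖y 0‖ := by
  have hanti : AntitoneOn (fun t => Real.exp (-(2 * γ) * t) * ‖y t‖ ^ 2) (Icc 0 T) := by
    have hder : ∀ t ∈ Ioo 0 T, HasDerivAt (fun t => Real.exp (-(2 * γ) * t) * ‖y t‖ ^ 2)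
        (Real.exp (-(2 * γ) * t) * (-(2 * γ)) * ‖y t‖ ^ 2 +
          Real.exp (-(2 * γ) * t) * (2 * inner ℝ (y t) (y' t))) t := by
      intro t ht
      have h1 : HasDerivAt (fun t : ℝ => -(2 * γ) * t) (-(2 * γ)) t := by
        simpa using (hasDerivAt_id t).const_mul (-(2 * γ))
      exact h1.exp.mul ((hd t ht).norm_sq)
    refine antitoneOn_of_deriv_nonpos (convex_Icc _ _) ?_ ?_ ?_
    · exact (by fun_prop : Continuous fun t : ℝ => Real.exp (-(2 * γ) * t)).continuousOn.mul
        (hc.norm.pow 2)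
    · rw [interior_Icc]
      exact fun t ht => (hder t ht).differentiableAt.differentiableWithinAt
    · rw [interior_Icc]
      intro t ht
      rw [(hder t ht).deriv, real_inner_comm]
      have := mul_le_mul_of_nonneg_left (hi t ht) (Real.exp_pos (-(2 * γ) * t)).le
      linarith
  have h := hanti ⟨le_rfl, ht.1.trans ht.2⟩ ht ht.1
  simp only [mul_zero, Real.exp_zero, one_mul] at h
  have h2 : ‖y t‖ ^ 2 ≤ (Real.exp (γ * t) * ‖y 0‖) ^ 2 := by
    have : ‖y t‖ ^ 2 = Real.exp (2 * γ * t) * (Real.exp (-(2 * γ) * t) * ‖y t‖ ^ 2) := by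
      rw [← mul_assoc, ← Real.exp_add]
      simp
    rw [this, mul_pow, ← Real.exp_nat_mul]
    refine (mul_le_mul_of_nonneg_left h (Real.exp_pos _).le).trans (le_of_eq ?_)
    congr 2
    push_cast
    ring
  exact (pow_le_pow_iff_left₀ (norm_nonneg _) (by positivity) two_ne_zero).1 h2

/-- A mild solution need not lie in the domain, but its time integral does. So the energy estimate
is applied to W = ∫ (y - z), which satisfies (W, W') ∈ G and W(0) = 0. -/
theorem IsMild.eqOn [CompleteSpace H] {G : Submodule ℝ (H × H)} {γ : ℝ}
    (hG : QuasiDissipative G γ) {x₀ : H} {y z : ℝ → H} (hy : IsMild G x₀ y) (hz : IsMild G x₀ z) :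
    EqOn y z (Ici 0) := by
  set w : ℝ → H := fun t => y t - z t with hw
  have hwc : ContinuousOn w (Ici 0) := hy.1.sub hz.1
  have hint : ∀ f : ℝ → H, ContinuousOn f (Ici 0) → ∀ t, 0 ≤ t →
      IntervalIntegrable f volume 0 t := fun f hf t ht =>
    (hf.mono (by rw [uIcc_of_le ht]; exact Icc_subset_Ici_self)).intervalIntegrable
  set W : ℝ → H := fun t => ∫ s in (0 : ℝ)..t, w s with hW
  have hmem : ∀ t, 0 ≤ t → (W t, w t) ∈ G := by
    intro t ht
    have := G.sub_mem (hy.2 t ht) (hz.2 t ht)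
    rw [Prod.mk_sub_mk, ← intervalIntegral.integral_sub (hint y hy.1 t ht) (hint z hz.1 t ht)] at this
    simpa using this
  have hder : ∀ t, 0 < t → HasDerivAt W (w t) t := by
    intro t ht
    refine intervalIntegral.integral_hasDerivAt_right (hint w hwc t ht.le) ?_ ?_
    · exact (hwc.mono Ioi_subset_Ici_self).stronglyMeasurableAtFilter isOpen_Ioi t ht
    · exact hwc.continuousAt (Ici_mem_nhds ht)
  have hWc : ∀ T, 0 ≤ T → ContinuousOn W (Icc 0 T) := by
    intro T hT
    have := intervalIntegral.continuousOn_primitive_interval (a := 0) (b := T) (μ := volume) (f := w)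
      ((hwc.mono (by rw [uIcc_of_le hT]; exact Icc_subset_Ici_self)).integrableOn_compact
        isCompact_uIcc)
    rwa [uIcc_of_le hT] at this
  have hW0 : ∀ t, 0 ≤ t → W t = 0 := by
    intro t ht
    have := norm_le_exp_of_hasDerivAt (hWc t ht) (fun s hs => hder s hs.1)
      (fun s hs => hG _ _ (hmem s hs.1.le)) (⟨ht, le_rfl⟩ : t ∈ Icc 0 t)
    have h0 : W 0 = 0 := by simp [hW]
    rw [h0, norm_zero, mul_zero] at this
    exact norm_le_zero_iff.1 this
  have hpos : ∀ t, 0 < t → w t = 0 := by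
    intro t ht
    have h1 : W =ᶠ[𝓝 t] fun _ => 0 := by
      filter_upwards [Ioi_mem_nhds ht] with s hs using hW0 s (le_of_lt hs)
    exact ((hder t ht).congr_of_eventuallyEq h1.symm).unique (hasDerivAt_const t 0)
  intro t ht
  refine sub_eq_zero.1 (?_ : w t = 0)
  rcases (mem_Ici.1 ht).eq_or_lt with h | h
  -- W is differentiated only at t > 0; the value at 0 follows by continuity from the right.
  · have h1 : Tendsto w (𝓝[>] 0) (𝓝 (w 0)) :=
      (hwc 0 self_mem_Ici).mono_left (nhdsWithin_mono _ Ioi_subset_Ici_self)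
    have h2 : Tendsto w (𝓝[>] 0) (𝓝 0) := by
      refine tendsto_const_nhds.congr' ?_
      filter_upwards [self_mem_nhdsWithin] with s hs using (hpos s hs).symm
    rw [← h]
    exact tendsto_nhds_unique h1 h2
  · exact hpos t h

/-- `R` is the resolvent of `G` at `s`. -/
structure IsResolvent (G : Submodule ℝ (H × H)) (s : ℝ) (R : H →L[ℝ] H) : Prop where
  mem : ∀ f, (R f, s • R f - f) ∈ G
  left_inv : ∀ x y, (x, y) ∈ G → R (s • x - y) = x

theorem QuasiDissipative.norm_le {G : Submodule ℝ (H × H)} {γ s : ℝ} (hG : QuasiDissipative G γ)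
    (hs : γ < s) {x y : H} (h : (x, y) ∈ G) : ‖x‖ ≤ (s - γ)⁻¹ * ‖s • x - y‖ := by
  have h1 : (s - γ) * ‖x‖ ^ 2 ≤ inner ℝ (s • x - y) x := by
    rw [inner_sub_left, real_inner_smul_left, real_inner_self_eq_norm_sq]
    linarith [hG x y h]
  have h2 := h1.trans (real_inner_le_norm _ _)
  have hpos : 0 < s - γ := sub_pos.2 hs
  rw [inv_mul_eq_div, le_div_iff₀ hpos]
  rcases (norm_nonneg x).eq_or_lt with h0 | h0
  · rw [← h0]; simp
  · nlinarith

theorem QuasiDissipative.exists_isResolvent {G : Submodule ℝ (H × H)} {γ s : ℝ}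
    (hG : QuasiDissipative G γ) (hs : γ < s) (hr : ∀ f, ∃ x y, (x, y) ∈ G ∧ s • x - y = f) :
    ∃ R : H →L[ℝ] H, IsResolvent G s R ∧ ∀ f, ‖R f‖ ≤ (s - γ)⁻¹ * ‖f‖ := by
  have huniq : ∀ x y x' y', (x, y) ∈ G → (x', y') ∈ G → s • x - y = s • x' - y' → x = x' := by
    intro x y x' y' h h' he
    have h1 := hG.norm_le hs (G.sub_mem h h')
    have h2 : s • (x - x') - (y - y') = 0 := by
      rw [smul_sub, sub_sub_sub_comm, he, sub_self]
    rw [h2, norm_zero, mul_zero] at h1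
    exact sub_eq_zero.1 (norm_le_zero_iff.1 h1)
  choose X Y hXY hf using hr
  have hY : ∀ f, Y f = s • X f - f := fun f => by rw [eq_sub_iff_add_eq, ← eq_sub_iff_add_eq', hf]
  let L : H →ₗ[ℝ] H :=
    { toFun := X
      map_add' := fun f g => huniq _ _ _ _ (hXY (f + g)) (G.add_mem (hXY f) (hXY g)) (by
        rw [hf, smul_add, add_sub_add_comm, hf, hf])
      map_smul' := fun r f => huniq _ _ _ _ (hXY (r • f)) (G.smul_mem r (hXY f)) (by
        rw [hf, RingHom.id_apply, smul_comm s r, ← smul_sub, hf]) }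
  have hb : ∀ f, ‖L f‖ ≤ (s - γ)⁻¹ * ‖f‖ := fun f => by
    have := hG.norm_le hs (hXY f)
    rwa [hf] at this
  refine ⟨L.mkContinuous _ hb, ⟨fun f => ?_, fun x y h => ?_⟩, hb⟩
  · have := hXY f
    rw [hY] at this
    exact this
  · exact huniq _ _ _ _ (hXY (s • x - y)) h (hf _)

/-- Both (s - r)RS and (s - r)SR equal S - R, by the resolvent identity. -/
theorem IsResolvent.commute {G : Submodule ℝ (H × H)} {s r : ℝ} {R S : H →L[ℝ] H}
    (hR : IsResolvent G s R) (hS : IsResolvent G r S) (hsr : s ≠ r) : Commute R S := by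
  have h1 : ∀ f, (s - r) • R (S f) = S f - R f := by
    intro f
    have := hR.left_inv _ _ (hS.mem f)
    rw [show s • S f - (r • S f - f) = (s - r) • S f + f by rw [sub_smul]; abel, map_add,
      map_smul] at this
    exact eq_sub_of_add_eq this
  have h2 : ∀ f, (s - r) • S (R f) = S f - R f := by
    intro f
    have := hS.left_inv _ _ (hR.mem f)
    rw [show r • R f - (s • R f - f) = f - (s - r) • R f by rw [sub_smul]; abel, map_sub,
      map_smul] at this
    rw [sub_eq_iff_eq_add, ← sub_eq_iff_eq_add'] at this
    exact this.symm
  refine ContinuousLinearMap.ext fun f => ?_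
  have := (h1 f).trans (h2 f).symm
  exact smul_right_injective H (sub_ne_zero.2 hsr) this

theorem IsResolvent.isClosed {G : Submodule ℝ (H × H)} {s : ℝ} {R : H →L[ℝ] H}
    (hR : IsResolvent G s R) : IsClosed (G : Set (H × H)) := by
  have : (G : Set (H × H)) = {q | R (s • q.1 - q.2) = q.1} := by
    ext ⟨x, y⟩
    refine ⟨hR.left_inv x y, fun h => ?_⟩
    have h1 := hR.mem (s • x - y)
    rw [show R (s • x - y) = x from h] at h1
    simpa using h1
  rw [this]
  exact isClosed_eq (by fun_prop) continuous_fst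

theorem tendsto_of_tendsto_dense {E : Type*} [NormedAddCommGroup E] [NormedSpace ℝ E]
    {T : ℕ → E →L[ℝ] E} {M : ℝ} (hM : ∀ n f, ‖T n f‖ ≤ M * ‖f‖) {D : Set E} (hD : Dense D)
    (h : ∀ x ∈ D, Tendsto (fun n => T n x) atTop (𝓝 x)) (f : E) :
    Tendsto (fun n => T n f) atTop (𝓝 f) := by
  rw [Metric.tendsto_atTop]
  intro e he
  have hM' : 0 < |M| + 1 := by positivity
  obtain ⟨x, hx, hfx⟩ := hD.exists_dist_lt f (show 0 < e / (2 * (|M| + 1)) by positivity)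
  obtain ⟨N, hN⟩ := Metric.tendsto_atTop.1 (h x hx) (e / 2) (by positivity)
  refine ⟨N, fun n hn => ?_⟩
  rw [dist_eq_norm] at hfx ⊢
  have h1 := hN n hn
  rw [dist_eq_norm] at h1
  have h2 : T n f - f = T n (f - x) + (T n x - x) - (f - x) := by rw [map_sub]; abel
  have h3 : ‖T n f - f‖ ≤ M * ‖f - x‖ + ‖T n x - x‖ + ‖f - x‖ := by
    rw [h2]
    exact (norm_sub_le _ _).trans (add_le_add_left ((norm_add_le _ _).trans
      (add_le_add_left (hM n _) _)) _)
  have h4 : (|M| + 1) * ‖f - x‖ < e / 2 := by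
    rw [lt_div_iff₀ (by positivity)] at hfx
    linarith
  nlinarith [le_abs_self M, norm_nonneg (f - x)]

/-- If f is orthogonal to the domain, then ⟪R f, f⟫ = 0, and dissipativity gives s‖R f‖² ≤ γ‖R f‖²,
so R f = 0. Then (0, -f) ∈ G, and single-valuedness forces f = 0. -/
theorem QuasiDissipative.dense [CompleteSpace H] {G : Submodule ℝ (H × H)} {γ s : ℝ}
    (hG : QuasiDissipative G γ) (hsv : ∀ y, (0, y) ∈ G → y = 0) (hs : γ < s) {R : H →L[ℝ] H}
    (hR : IsResolvent G s R) : Dense {x | ∃ y, (x, y) ∈ G} := by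
  set D : Submodule ℝ H := G.map (LinearMap.fst ℝ H H) with hD
  have hDset : {x | ∃ y, (x, y) ∈ G} = (D : Set H) := by
    ext x
    simp [hD]
  rw [hDset, Submodule.dense_iff_topologicalClosure_eq_top, Submodule.topologicalClosure_eq_top_iff,
    Submodule.eq_bot_iff]
  intro f hf
  have hmem := hR.mem f
  have h1 : inner ℝ (R f) f = 0 :=
    hf (R f) (Submodule.mem_map.2 ⟨_, hmem, rfl⟩)
  have h2 := hG _ _ hmem
  rw [inner_sub_left, real_inner_smul_left, real_inner_self_eq_norm_sq, real_inner_comm, h1,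
    sub_zero] at h2
  have h3 : ‖R f‖ = 0 := by
    by_contra hne
    have : 0 < ‖R f‖ ^ 2 := by positivity
    nlinarith
  rw [norm_eq_zero] at h3
  rw [h3] at hmem
  exact hsv f (by simpa using G.neg_mem hmem)

/-- The Yosida approximation `s (s R - 1)`. -/
def yosida (s : ℝ) (R : H →L[ℝ] H) : H →L[ℝ] H := s • (s • R - 1)

theorem yosida_apply (s : ℝ) (R : H →L[ℝ] H) (f : H) :
    yosida s R f = s • (s • R f - f) := rfl

theorem hasDerivAt_exp_apply [CompleteSpace H] (A : H →L[ℝ] H) (x : H) (t : ℝ) :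
    HasDerivAt (fun t : ℝ => NormedSpace.exp (t • A) x) (A (NormedSpace.exp (t • A) x)) t := by
  have := (hasDerivAt_exp_smul_const' (𝕂 := ℝ) A t).clm_apply (hasDerivAt_const t x)
  simpa using this

theorem continuous_exp_apply [CompleteSpace H] (A : H →L[ℝ] H) (x : H) :
    Continuous (fun t : ℝ => NormedSpace.exp (t • A) x) :=
  continuous_iff_continuousAt.2 fun t => (hasDerivAt_exp_apply A x t).continuousAt

theorem norm_exp_apply_le [CompleteSpace H] {A : H →L[ℝ] H} {γ : ℝ}
    (hA : ∀ x, inner ℝ (A x) x ≤ γ * ‖x‖ ^ 2) (x : H) {t : ℝ} (ht : 0 ≤ t) :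
    ‖NormedSpace.exp (t • A) x‖ ≤ Real.exp (γ * t) * ‖x‖ := by
  have := norm_le_exp_of_hasDerivAt (γ := γ) (T := t) (continuous_exp_apply A x).continuousOn
    (fun s _ => hasDerivAt_exp_apply A x s) (fun s _ => hA _) ⟨ht, le_rfl⟩
  simpa using this

/-- Interpolate by r ↦ e^{(t-r)B} e^{rA} x. Commutativity turns its derivative into the two
exponentials applied to Ax - Bx, whose norm is bounded uniformly in r. -/
theorem norm_exp_sub_exp_le [CompleteSpace H] {A B : H →L[ℝ] H} {γ : ℝ}
    (hA : ∀ x, inner ℝ (A x) x ≤ γ * ‖x‖ ^ 2) (hB : ∀ x, inner ℝ (B x) x ≤ γ * ‖x‖ ^ 2)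
    (hAB : Commute A B) (x : H) {t : ℝ} (ht : 0 ≤ t) :
    ‖NormedSpace.exp (t • A) x - NormedSpace.exp (t • B) x‖ ≤
      t * Real.exp (γ * t) * ‖A x - B x‖ := by
  set φ : ℝ → H := fun r => NormedSpace.exp ((t - r) • B) (NormedSpace.exp (r • A) x) with hφ
  have hder : ∀ r, HasDerivAt φ
      (NormedSpace.exp ((t - r) • B) (NormedSpace.exp (r • A) (A x - B x))) r := by
    intro r
    have h1 : HasDerivAt (fun r : ℝ => t - r) (-1) r := by
      simpa using (hasDerivAt_id r).const_sub t
    have h2 := (hasDerivAt_exp_smul_const (𝕂 := ℝ) B (t - r)).scomp r h1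
    have h3 := h2.clm_apply (hasDerivAt_exp_apply A x r)
    refine h3.congr_deriv ?_
    have c1 : Commute A (NormedSpace.exp (r • A)) := ((Commute.refl A).smul_right r).exp_right
    have c2 : Commute B (NormedSpace.exp (r • A)) := (hAB.symm.smul_right r).exp_right
    have e1 := congrArg (fun L : H →L[ℝ] H => L x) c1.eq
    have e2 := congrArg (fun L : H →L[ℝ] H => L x) c2.eq
    simp only [mul_apply_eq_comp] at e1 e2
    simp [e1, e2, map_sub]
    abel
  have hbd : ∀ r ∈ Ico 0 t,
      ‖NormedSpace.exp ((t - r) • B) (NormedSpace.exp (r • A) (A x - B x))‖ ≤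
        Real.exp (γ * t) * ‖A x - B x‖ := by
    intro r hr
    refine (norm_exp_apply_le hB _ (sub_nonneg.2 hr.2.le)).trans ?_
    refine (mul_le_mul_of_nonneg_left (norm_exp_apply_le hA _ hr.1) (Real.exp_pos _).le).trans ?_
    rw [← mul_assoc, ← Real.exp_add]
    exact le_of_eq (by ring_nf)
  have h := norm_image_sub_le_of_norm_deriv_le_segment' (a := 0) (b := t)
    (fun r _ => (hder r).hasDerivWithinAt) hbd t ⟨ht, le_rfl⟩
  simp only [hφ, sub_self, zero_smul, NormedSpace.exp_zero, sub_zero,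
    one_apply_eq_self] at h
  linarith

theorem integral_exp_apply [CompleteSpace H] (A : H →L[ℝ] H) (x : H) (t : ℝ) :
    A (∫ s in (0 : ℝ)..t, NormedSpace.exp (s • A) x) = NormedSpace.exp (t • A) x - x := by
  rw [← ContinuousLinearMap.intervalIntegral_comp_comm _
    ((continuous_exp_apply A x).intervalIntegrable _ _),
    intervalIntegral.integral_eq_sub_of_hasDerivAt (fun s _ => hasDerivAt_exp_apply A x s)
      ((A.continuous.comp (continuous_exp_apply A x)).intervalIntegrable _ _)]
  simp

theorem IsResolvent.inner_yosida_le {s γ : ℝ} (hs : γ < s) {R : H →L[ℝ] H}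
    (hb : ∀ f, ‖R f‖ ≤ (s - γ)⁻¹ * ‖f‖) (x : H) :
    inner ℝ (yosida s R x) x ≤ s * γ * (s - γ)⁻¹ * ‖x‖ ^ 2 := by
  rw [yosida_apply, real_inner_smul_left, inner_sub_left, real_inner_smul_left,
    real_inner_self_eq_norm_sq]
  have h1 : inner ℝ (R x) x ≤ (s - γ)⁻¹ * ‖x‖ ^ 2 := by
    refine (real_inner_le_norm _ _).trans ?_
    nlinarith [mul_le_mul_of_nonneg_right (hb x) (norm_nonneg x)]
  have h2 := mul_le_mul_of_nonneg_left h1 (sq_nonneg s)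
  have h3 : s * γ * (s - γ)⁻¹ = s ^ 2 * (s - γ)⁻¹ - s := by
    have : s - γ ≠ 0 := (sub_pos.2 hs).ne'
    field_simp
    ring
  rw [h3]
  linarith

theorem uniformCauchySeqOn_of_dense {E : Type*} [NormedAddCommGroup E] [NormedSpace ℝ E]
    {T : ℕ → ℝ → E →L[ℝ] E} {S : Set ℝ} {M : ℝ} (hM : ∀ n, ∀ t ∈ S, ∀ f, ‖T n t f‖ ≤ M * ‖f‖)
    {D : Set E} (hD : Dense D)
    (h : ∀ x ∈ D, UniformCauchySeqOn (fun n t => T n t x) atTop S) (f : E) :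
    UniformCauchySeqOn (fun n t => T n t f) atTop S := by
  rw [Metric.uniformCauchySeqOn_iff]
  intro e he
  have hM' : 0 < |M| + 1 := by positivity
  obtain ⟨x, hx, hfx⟩ := hD.exists_dist_lt f (show 0 < e / (4 * (|M| + 1)) by positivity)
  obtain ⟨N, hN⟩ := Metric.uniformCauchySeqOn_iff.1 (h x hx) (e / 2) (by positivity)
  refine ⟨N, fun m hm n hn t ht => ?_⟩
  have h1 := hN m hm n hn t ht
  rw [dist_eq_norm] at hfx h1 ⊢
  have h2 : T m t f - T n t f = T m t (f - x) + (T m t x - T n t x) - T n t (f - x) := by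
    rw [map_sub, map_sub]; abel
  have h3 : ‖T m t f - T n t f‖ ≤ M * ‖f - x‖ + ‖T m t x - T n t x‖ + M * ‖f - x‖ := by
    rw [h2]
    exact (norm_sub_le _ _).trans (add_le_add ((norm_add_le _ _).trans
      (add_le_add_left (hM m t ht _) _)) (hM n t ht _))
  have h4 : (|M| + 1) * ‖f - x‖ < e / 4 := by
    rw [lt_div_iff₀ (by positivity)] at hfx
    linarith
  nlinarith [le_abs_self M, norm_nonneg (f - x)]

/-- Hille–Yosida theorem for quasi-dissipative linear relations with full resolvent range. -/
theorem QuasiDissipative.exists_isMild [CompleteSpace H] {G : Submodule ℝ (H × H)} {γ s₀ : ℝ}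
    (hG : QuasiDissipative G γ) (hsv : ∀ y, (0, y) ∈ G → y = 0)
    (hr : ∀ s, s₀ < s → ∀ f, ∃ x y, (x, y) ∈ G ∧ s • x - y = f) (x₀ : H) :
    ∃ y, IsMild G x₀ y ∧ ∀ t, 0 ≤ t → ‖y t‖ ≤ Real.exp (γ * t) * ‖x₀‖ := by
  -- The shift makes every s n = σ + n positive, above s₀, and at least 1 above γ.
  set σ : ℝ := max (max s₀ γ) 0 + 1 with hσ
  have hσ1 : s₀ + 1 ≤ σ := by
    have := (le_max_left s₀ γ).trans (le_max_left _ (0 : ℝ)); linarith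
  have hσ2 : γ + 1 ≤ σ := by
    have := (le_max_right s₀ γ).trans (le_max_left _ (0 : ℝ)); linarith
  have hσ3 : 1 ≤ σ := by
    have := le_max_right (max s₀ γ) (0 : ℝ); linarith
  set s : ℕ → ℝ := fun n => σ + n with hs
  have hn0 : ∀ n : ℕ, (0 : ℝ) ≤ n := fun n => Nat.cast_nonneg n
  have hsγ : ∀ n, γ < s n := fun n => by have := hn0 n; simp only [hs]; linarith
  have hs0 : ∀ n, s₀ < s n := fun n => by have := hn0 n; simp only [hs]; linarith
  have hspos : ∀ n, 0 < s n := fun n => by have := hn0 n; simp only [hs]; linarith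
  have hs1 : ∀ n, 1 ≤ s n - γ := fun n => by have := hn0 n; simp only [hs]; linarith
  have hsinv : ∀ n, (s n - γ)⁻¹ ≤ 1 := fun n => inv_le_one_of_one_le₀ (hs1 n)
  have hsinv0 : ∀ n, 0 < (s n - γ)⁻¹ := fun n => inv_pos.2 (sub_pos.2 (hsγ n))
  have hsinf : Tendsto (fun n => s n - γ) atTop atTop :=
    tendsto_atTop_add_const_right _ _ (tendsto_atTop_add_const_left _ _
      tendsto_natCast_atTop_atTop)
  have hratio : ∀ n, s n * (s n - γ)⁻¹ = 1 + γ * (s n - γ)⁻¹ := fun n => by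
    have : s n - γ ≠ 0 := (sub_pos.2 (hsγ n)).ne'
    field_simp
    ring
  have hratio_le : ∀ n, s n * (s n - γ)⁻¹ ≤ 1 + |γ| := fun n => by
    rw [hratio]
    have := mul_le_mul (le_abs_self γ) (hsinv n) (hsinv0 n).le (abs_nonneg γ)
    linarith
  have hratio_lim : Tendsto (fun n => s n * (s n - γ)⁻¹) atTop (𝓝 1) := by
    simp only [hratio]
    simpa using (hsinf.inv_tendsto_atTop.const_mul γ).const_add 1
  choose R hR hRb using fun n => hG.exists_isResolvent (hsγ n) (hr (s n) (hs0 n))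
  have hDd := hG.dense hsv (hsγ 0) (hR 0)
  -- J n tends strongly to the identity, and (J n f, A n f) ∈ G: the Yosida operators approximate G
  -- through J n.
  set J : ℕ → H →L[ℝ] H := fun n => s n • R n with hJ
  have hJb : ∀ n f, ‖J n f‖ ≤ (1 + |γ|) * ‖f‖ := fun n f => by
    simp only [hJ, smul_apply, norm_smul, Real.norm_of_nonneg (hspos n).le]
    calc s n * ‖R n f‖ ≤ s n * ((s n - γ)⁻¹ * ‖f‖) :=
          mul_le_mul_of_nonneg_left (hRb n f) (hspos n).le
      _ = s n * (s n - γ)⁻¹ * ‖f‖ := by ring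
      _ ≤ _ := mul_le_mul_of_nonneg_right (hratio_le n) (norm_nonneg f)
  have hRA : ∀ n x y, (x, y) ∈ G → J n x - x = R n y := fun n x y h => by
    have := (hR n).left_inv x y h
    rw [map_sub, map_smul, sub_eq_iff_eq_add] at this
    simp only [hJ, smul_apply, this]
    abel
  have hJlim : ∀ f, Tendsto (fun n => J n f) atTop (𝓝 f) := by
    refine tendsto_of_tendsto_dense hJb hDd ?_
    rintro x ⟨y, hxy⟩
    rw [tendsto_iff_norm_sub_tendsto_zero]
    refine squeeze_zero (fun n => norm_nonneg _) (fun n => ?_)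
      (by simpa using hsinf.inv_tendsto_atTop.mul_const ‖y‖)
    rw [hRA n x y hxy]
    exact hRb n y
  set A : ℕ → H →L[ℝ] H := fun n => yosida (s n) (R n) with hA
  have hJA : ∀ n f, (J n f, A n f) ∈ G := fun n f => G.smul_mem (s n) ((hR n).mem f)
  have hAD : ∀ n x y, (x, y) ∈ G → A n x = J n y := fun n x y h => by
    have := hRA n x y h
    simp only [hJ, smul_apply] at this
    simp only [hA, hJ, yosida_apply, smul_apply, this]
  set Γ : ℝ := (1 + |γ|) * |γ| with hΓ
  have hAn : ∀ n x, inner ℝ (A n x) x ≤ s n * γ * (s n - γ)⁻¹ * ‖x‖ ^ 2 := fun n x =>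
    IsResolvent.inner_yosida_le (hsγ n) (hRb n) x
  have hAΓ : ∀ n x, inner ℝ (A n x) x ≤ Γ * ‖x‖ ^ 2 := fun n x => by
    refine (hAn n x).trans (mul_le_mul_of_nonneg_right ?_ (sq_nonneg _))
    rw [mul_right_comm]
    refine (mul_le_mul_of_nonneg_left (le_abs_self γ)
      (mul_nonneg (hspos n).le (hsinv0 n).le)).trans ?_
    exact mul_le_mul_of_nonneg_right (hratio_le n) (abs_nonneg γ)
  have hΓ0 : 0 ≤ Γ := by positivity
  have hcomm : ∀ m n, Commute (A m) (A n) := by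
    intro m n
    have hRc : Commute (R m) (R n) := by
      rcases eq_or_ne m n with h | h
      · rw [h]
      · exact (hR m).commute (hR n) (by simpa [hs] using h)
    have h1 : Commute (s m • R m - 1) (s n • R n - 1) :=
      (((hRc.smul_left _).smul_right _).sub_right (Commute.one_right _)).sub_left
        (Commute.one_left _)
    exact (h1.smul_left _).smul_right _
  have hexpb : ∀ T : ℝ, ∀ n, ∀ t ∈ Icc 0 T, ∀ f,
      ‖NormedSpace.exp (t • A n) f‖ ≤ Real.exp (Γ * T) * ‖f‖ := fun T n t ht f =>
    (norm_exp_apply_le (hAΓ n) f ht.1).trans (mul_le_mul_of_nonneg_right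
      (Real.exp_le_exp.2 (mul_le_mul_of_nonneg_left ht.2 hΓ0)) (norm_nonneg f))
  have hcauchy : ∀ T : ℝ, UniformCauchySeqOn (fun n t => NormedSpace.exp (t • A n) x₀) atTop
      (Icc 0 T) := by
    intro T
    refine uniformCauchySeqOn_of_dense (hexpb T) hDd ?_ x₀
    rintro x ⟨y, hxy⟩
    rw [Metric.uniformCauchySeqOn_iff]
    intro e he
    have hM : 0 < |T| * Real.exp (Γ * T) + 1 := by positivity
    have hAx : CauchySeq (fun n => A n x) := by
      simp only [hAD _ x y hxy]
      exact (hJlim y).cauchySeq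
    obtain ⟨N, hN⟩ := Metric.cauchySeq_iff.1 hAx (e / (|T| * Real.exp (Γ * T) + 1))
      (by positivity)
    refine ⟨N, fun m hm n hn t ht => ?_⟩
    have h1 := hN m hm n hn
    rw [dist_eq_norm, lt_div_iff₀ hM] at h1
    rw [dist_eq_norm]
    refine (norm_exp_sub_exp_le (hAΓ m) (hAΓ n) (hcomm m n) x ht.1).trans_lt ?_
    refine lt_of_le_of_lt ?_ h1
    rw [mul_comm ‖_‖]
    refine mul_le_mul_of_nonneg_right ?_ (norm_nonneg _)
    have h2 : t * Real.exp (Γ * t) ≤ |T| * Real.exp (Γ * T) :=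
      mul_le_mul (ht.2.trans (le_abs_self T))
        (Real.exp_le_exp.2 (mul_le_mul_of_nonneg_left ht.2 hΓ0)) (Real.exp_pos _).le (abs_nonneg T)
    linarith
  have hlim : ∀ t : ℝ, ∃ z, 0 ≤ t →
      Tendsto (fun n => NormedSpace.exp (t • A n) x₀) atTop (𝓝 z) := by
    intro t
    by_cases ht : 0 ≤ t
    · obtain ⟨z, hz⟩ := cauchySeq_tendsto_of_complete
        ((hcauchy t).cauchySeq (⟨ht, le_rfl⟩ : t ∈ Icc 0 t))
      exact ⟨z, fun _ => hz⟩
    · exact ⟨0, fun h => absurd h ht⟩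
  choose y hy using hlim
  have hunif : ∀ T : ℝ, TendstoUniformlyOn (fun n t => NormedSpace.exp (t • A n) x₀) y atTop
      (Icc 0 T) := fun T =>
    (hcauchy T).tendstoUniformlyOn_of_tendsto fun t ht => hy t ht.1
  have hcontT : ∀ T : ℝ, ContinuousOn y (Icc 0 T) := fun T =>
    (hunif T).continuousOn (Frequently.of_forall fun n => (continuous_exp_apply _ _).continuousOn)
  have hcont : ContinuousOn y (Ici 0) := by
    intro t ht
    refine ((hcontT (t + 1)) t ⟨ht, by linarith⟩).mono_of_mem_nhdsWithin ?_
    rw [← Ici_inter_Iic]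
    exact inter_mem self_mem_nhdsWithin (mem_nhdsWithin_of_mem_nhds (Iic_mem_nhds (by linarith)))
  refine ⟨y, ⟨hcont, fun t ht => ?_⟩, fun t ht => ?_⟩
  · have hI : Tendsto (fun n => ∫ r in (0 : ℝ)..t, NormedSpace.exp (r • A n) x₀) atTop
        (𝓝 (∫ r in (0 : ℝ)..t, y r)) := by
      refine intervalIntegral.tendsto_integral_filter_of_dominated_convergence
        (fun _ => Real.exp (Γ * t) * ‖x₀‖) ?_ ?_ intervalIntegrable_const ?_
      · exact Eventually.of_forall fun n => (continuous_exp_apply _ _).aestronglyMeasurable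
      · refine Eventually.of_forall fun n => ae_of_all _ fun r hr => ?_
        rw [uIoc_of_le ht] at hr
        exact hexpb t n r ⟨hr.1.le, hr.2⟩ x₀
      · refine ae_of_all _ fun r hr => ?_
        rw [uIoc_of_le ht] at hr
        exact hy r hr.1.le
    have hJI : Tendsto (fun n => J n (∫ r in (0 : ℝ)..t, NormedSpace.exp (r • A n) x₀)) atTop
        (𝓝 (∫ r in (0 : ℝ)..t, y r)) := by
      have h1 : Tendsto (fun n => J n ((∫ r in (0 : ℝ)..t, NormedSpace.exp (r • A n) x₀) -
          ∫ r in (0 : ℝ)..t, y r)) atTop (𝓝 0) := by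
        refine squeeze_zero_norm (fun n => hJb n _) ?_
        simpa using (tendsto_iff_norm_sub_tendsto_zero.1 hI).const_mul (1 + |γ|)
      simpa using h1.add (hJlim (∫ r in (0 : ℝ)..t, y r))
    -- The pair (J n ∫ e^{rA n}x₀, e^{tA n}x₀ - x₀) lies in G for each n, and G is closed.
    refine (hR 0).isClosed.mem_of_tendsto (hJI.prodMk_nhds ((hy t ht).sub_const x₀))
      (Eventually.of_forall fun n => ?_)
    rw [← integral_exp_apply]
    exact hJA n _
  · have h1 : Tendsto (fun n => Real.exp (s n * γ * (s n - γ)⁻¹ * t) * ‖x₀‖) atTop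
        (𝓝 (Real.exp (γ * t) * ‖x₀‖)) := by
      have h2 : Tendsto (fun n => s n * γ * (s n - γ)⁻¹) atTop (𝓝 γ) := by
        simpa [mul_right_comm] using hratio_lim.mul_const γ
      exact ((Real.continuous_exp.tendsto _).comp (h2.mul_const t)).mul_const _
    exact le_of_tendsto_of_tendsto' (hy t ht).norm h1 fun n => norm_exp_apply_le (hAn n) x₀ ht

/-- Generation theorem for a relation on a Banach space that is quasi-dissipative for an equivalent
Hilbertian norm. -/
theorem exists_isMild_of_equiv [CompleteSpace H] {E : Type*} [NormedAddCommGroup E]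
    [NormedSpace ℝ E] [CompleteSpace E] (Ψ : E ≃L[ℝ] H) {G : Submodule ℝ (E × E)} {γ s₀ : ℝ}
    (hG : ∀ x y, (x, y) ∈ G → inner ℝ (Ψ y) (Ψ x) ≤ γ * ‖Ψ x‖ ^ 2)
    (hsv : ∀ y, (0, y) ∈ G → y = 0)
    (hr : ∀ s, s₀ < s → ∀ f, ∃ x y, (x, y) ∈ G ∧ s • x - y = f) :
    ∃ C : ℝ, 0 < C ∧ ∀ x₀ : E, ∃ y, IsMild G x₀ y ∧ (∀ z, IsMild G x₀ z → EqOn z y (Ici 0)) ∧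
      ∀ t, 0 ≤ t → ‖y t‖ ≤ C * Real.exp (γ * t) * ‖x₀‖ := by
  set L : (H × H) →ₗ[ℝ] (E × E) :=
    (Ψ.symm : H →L[ℝ] E).toLinearMap.prodMap (Ψ.symm : H →L[ℝ] E).toLinearMap with hL
  set G' : Submodule ℝ (H × H) := G.comap L with hG'
  have hmem : ∀ x y, (x, y) ∈ G' ↔ (Ψ.symm x, Ψ.symm y) ∈ G := fun x y => Iff.rfl
  have hG2 : QuasiDissipative G' γ := fun x y h => by
    simpa using hG _ _ ((hmem x y).1 h)
  have hfwd : ∀ x₀ z, IsMild G x₀ z → IsMild G' (Ψ x₀) (fun t => Ψ (z t)) := by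
    intro x₀ z hz
    refine ⟨Ψ.continuous.comp_continuousOn hz.1, fun t ht => ?_⟩
    rw [hmem, map_sub, Ψ.symm_apply_apply, Ψ.symm_apply_apply,
      ← ContinuousLinearEquiv.coe_coe Ψ.symm, ← ContinuousLinearMap.intervalIntegral_comp_comm]
    · simpa using hz.2 t ht
    · exact ((Ψ.continuous.comp_continuousOn hz.1).mono
        (by rw [uIcc_of_le ht]; exact Icc_subset_Ici_self)).intervalIntegrable
  refine ⟨(‖(Ψ.symm : H →L[ℝ] E)‖ + 1) * (‖(Ψ : E →L[ℝ] H)‖ + 1), by positivity, fun x₀ => ?_⟩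
  obtain ⟨y, hy, hyb⟩ := hG2.exists_isMild (s₀ := s₀)
    (fun y h => by
      rw [hmem, map_zero] at h
      simpa using hsv _ h)
    (fun s hs f => by
      obtain ⟨x, y, h, he⟩ := hr s hs (Ψ.symm f)
      refine ⟨Ψ x, Ψ y, by simpa [hmem] using h, ?_⟩
      rw [← map_smul, ← map_sub, he, Ψ.apply_symm_apply]) (Ψ x₀)
  refine ⟨fun t => Ψ.symm (y t), ⟨Ψ.symm.continuous.comp_continuousOn hy.1, fun t ht => ?_⟩,
    fun z hz t ht => ?_, fun t ht => ?_⟩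
  · have h1 := (hmem _ _).1 (hy.2 t ht)
    rw [map_sub, Ψ.symm_apply_apply, ← ContinuousLinearEquiv.coe_coe Ψ.symm,
      ← ContinuousLinearMap.intervalIntegral_comp_comm] at h1
    · exact h1
    · exact (hy.1.mono (by rw [uIcc_of_le ht]; exact Icc_subset_Ici_self)).intervalIntegrable
  · have := (hfwd x₀ z hz).eqOn hG2 hy ht
    simp [← this]
  · have h1 : ‖Ψ.symm (y t)‖ ≤ (‖(Ψ.symm : H →L[ℝ] E)‖ + 1) * ‖y t‖ :=
      ((Ψ.symm : H →L[ℝ] E).le_opNorm _).trans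
        (mul_le_mul_of_nonneg_right (by linarith) (norm_nonneg _))
    have h2 : ‖Ψ x₀‖ ≤ (‖(Ψ : E →L[ℝ] H)‖ + 1) * ‖x₀‖ :=
      ((Ψ : E →L[ℝ] H).le_opNorm _).trans
        (mul_le_mul_of_nonneg_right (by linarith) (norm_nonneg _))
    calc ‖Ψ.symm (y t)‖ ≤ (‖(Ψ.symm : H →L[ℝ] E)‖ + 1) *
          (Real.exp (γ * t) * ((‖(Ψ : E →L[ℝ] H)‖ + 1) * ‖x₀‖)) := by
          refine h1.trans (mul_le_mul_of_nonneg_left ((hyb t ht).trans ?_) (by positivity))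
          exact mul_le_mul_of_nonneg_left h2 (Real.exp_pos _).le
      _ = _ := by ring

/-- Generation theorem for a relation on a Banach space that is quasi-dissipative for the Hilbertian
norm `‖T x‖`, where `T` is bounded below. -/
theorem exists_isMild_of_bounded_below [CompleteSpace H] {E : Type*} [NormedAddCommGroup E]
    [NormedSpace ℝ E] [CompleteSpace E] (T : E →L[ℝ] H) {N : ℝ} (hN : 0 ≤ N)
    (hT : ∀ x, ‖x‖ ≤ N * ‖T x‖) {G : Submodule ℝ (E × E)} {γ s₀ : ℝ}
    (hG : ∀ x y, (x, y) ∈ G → inner ℝ (T y) (T x) ≤ γ * ‖T x‖ ^ 2)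
    (hsv : ∀ y, (0, y) ∈ G → y = 0)
    (hr : ∀ s, s₀ < s → ∀ f, ∃ x y, (x, y) ∈ G ∧ s • x - y = f) :
    ∃ C : ℝ, 0 < C ∧ ∀ x₀ : E, ∃ y, IsMild G x₀ y ∧ (∀ z, IsMild G x₀ z → EqOn z y (Ici 0)) ∧
      ∀ t, 0 ≤ t → ‖y t‖ ≤ C * Real.exp (γ * t) * ‖x₀‖ := by
  -- T need not be onto; its closed range is itself a Hilbert space isomorphic to E.
  have hanti : AntilipschitzWith ⟨N, hN⟩ T := T.antilipschitz_of_bound hT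
  have hclosed : IsClosed (range T) := hanti.isClosed_range T.uniformContinuous
  have hclosed' : IsClosed (T.range : Set H) := hclosed
  have : CompleteSpace T.range := hclosed'.completeSpace_coe
  exact exists_isMild_of_equiv (T.equivRange hanti.injective hclosed)
    (fun x y hxy => hG x y hxy) hsv hr

end Abstract

/-! ### One-dimensional Sobolev calculus: primitives, weak derivatives and traces. -/

/-- Lebesgue measure on `(0,1)`. -/
abbrev unitMeasure : Measure ℝ := volume.restrict (Ioo (0 : ℝ) 1)

instance : IsProbabilityMeasure unitMeasure := ⟨by simp⟩

/-- `F` is a primitive on `[0,1]` of `f ∈ L²(0,1)`. -/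
structure Prim (F f : ℝ → ℝ) : Prop where
  memLp : MemLp f 2 unitMeasure
  eq : ∀ x ∈ Icc (0 : ℝ) 1, F x = F 0 + ∫ s in (0 : ℝ)..x, f s

theorem memLp_mul_continuousOn {F f : ℝ → ℝ} (hF : ContinuousOn F (Icc 0 1))
    (hf : MemLp f 2 unitMeasure) : MemLp (fun x => F x * f x) 2 unitMeasure := by
  obtain ⟨C, hC⟩ := isCompact_Icc.exists_bound_of_continuousOn hF
  have h1 : MemLp F ⊤ unitMeasure := by
    refine memLp_top_of_bound
      ((hF.mono Ioo_subset_Icc_self).aestronglyMeasurable measurableSet_Ioo) C ?_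
    filter_upwards [ae_restrict_mem measurableSet_Ioo] with x hx
      using hC x (Ioo_subset_Icc_self hx)
  exact hf.mul' h1

theorem memLp_of_continuousOn {F : ℝ → ℝ} (hF : ContinuousOn F (Icc 0 1)) :
    MemLp F 2 unitMeasure := by
  simpa using memLp_mul_continuousOn hF (memLp_const (1 : ℝ))

theorem intervalIntegrable_of_integrable {f : ℝ → ℝ} (hf : Integrable f unitMeasure) {x : ℝ}
    (hx : x ∈ Icc (0 : ℝ) 1) : IntervalIntegrable f volume 0 x := by
  rw [intervalIntegrable_iff_integrableOn_Ioo_of_le hx.1]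
  exact IntegrableOn.mono_set hf (Ioo_subset_Ioo_right hx.2)

theorem integral_unit_eq (f : ℝ → ℝ) :
    ∫ x in Ioo (0 : ℝ) 1, f x = ∫ x in (0 : ℝ)..1, f x := by
  rw [intervalIntegral.integral_of_le zero_le_one, integral_Ioc_eq_integral_Ioo]

theorem intervalIntegral_congr_unit {f g : ℝ → ℝ} (h : f =ᵐ[unitMeasure] g) {x : ℝ}
    (hx : x ∈ Icc (0 : ℝ) 1) : ∫ s in (0 : ℝ)..x, f s = ∫ s in (0 : ℝ)..x, g s := by
  rw [intervalIntegral.integral_of_le hx.1, intervalIntegral.integral_of_le hx.1,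
    integral_Ioc_eq_integral_Ioo, integral_Ioc_eq_integral_Ioo]
  exact integral_congr_ae (ae_restrict_of_ae_restrict_of_subset (Ioo_subset_Ioo_right hx.2) h)

theorem eqOn_of_ae_eq_unit {F G : ℝ → ℝ} (hF : ContinuousOn F (Icc 0 1))
    (hG : ContinuousOn G (Icc 0 1)) (h : F =ᵐ[unitMeasure] G) : EqOn F G (Icc 0 1) := by
  refine Measure.eqOn_Icc_of_ae_eq volume zero_ne_one ?_ hF hG
  rwa [← restrict_Ioo_eq_restrict_Icc]

/-- The square of the mean of `|f|` over `(0,1)` is at most the mean of the square. -/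
theorem sq_integral_abs_le {f : ℝ → ℝ} (hf : MemLp f 2 unitMeasure) :
    (∫ x in Ioo (0 : ℝ) 1, |f x|) ^ 2 ≤ ∫ x in Ioo (0 : ℝ) 1, f x ^ 2 := by
  set A := ∫ x in Ioo (0 : ℝ) 1, |f x| with hA
  have hi : Integrable f unitMeasure := hf.integrable one_le_two
  have h0 : 0 ≤ ∫ x in Ioo (0 : ℝ) 1, (|f x| - A) ^ 2 := integral_nonneg fun x => sq_nonneg _
  have h1 : ∫ x in Ioo (0 : ℝ) 1, (|f x| - A) ^ 2 =
      (∫ x in Ioo (0 : ℝ) 1, f x ^ 2) - 2 * A * A + A ^ 2 := by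
    have : ∀ x, (|f x| - A) ^ 2 = f x ^ 2 - 2 * A * |f x| + A ^ 2 := fun x => by
      rw [sub_sq, sq_abs]; ring
    simp only [this]
    rw [integral_add, integral_sub, integral_const_mul]
    · simp [hA]
    · exact hf.integrable_sq
    · exact hi.abs.const_mul _
    · exact hf.integrable_sq.sub (hi.abs.const_mul _)
    · exact integrable_const _
  linarith

namespace Prim

variable {F G f g : ℝ → ℝ}

theorem integrable (h : Prim F f) : Integrable f unitMeasure := h.memLp.integrable one_le_two

theorem continuousOn (h : Prim F f) : ContinuousOn F (Icc 0 1) := by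
  have h1 : ContinuousOn (fun x => F 0 + ∫ s in (0 : ℝ)..x, f s) (Icc 0 1) := by
    have h2 := intervalIntegral.continuousOn_primitive_interval (a := 0) (b := 1) (μ := volume)
      (f := f) (by
        rw [uIcc_of_le zero_le_one, IntegrableOn, ← restrict_Ioo_eq_restrict_Icc]
        exact h.integrable)
    rw [uIcc_of_le zero_le_one] at h2
    exact continuousOn_const.add h2
  exact h1.congr h.eq

theorem memLp_left (h : Prim F f) : MemLp F 2 unitMeasure := memLp_of_continuousOn h.continuousOn

theorem congr (h : Prim F f) (hF : EqOn G F (Icc 0 1)) (hf : f =ᵐ[unitMeasure] g) : Prim G g where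
  memLp := (memLp_congr_ae hf).1 h.memLp
  eq x hx := by
    rw [hF hx, hF ⟨le_rfl, zero_le_one⟩, h.eq x hx, intervalIntegral_congr_unit hf hx]

theorem of_integral (hf : MemLp f 2 unitMeasure) (C : ℝ) :
    Prim (fun x => C + ∫ s in (0 : ℝ)..x, f s) f where
  memLp := hf
  eq x _ := by simp

theorem of_hasDerivAt (h : ∀ x, HasDerivAt F (f x) x) (hf : Continuous f) : Prim F f where
  memLp := memLp_of_continuousOn hf.continuousOn
  eq x _ := by
    rw [intervalIntegral.integral_eq_sub_of_hasDerivAt (fun x _ => h x)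
      (hf.intervalIntegrable _ _)]
    ring

theorem integral_eq (h : Prim F f) : ∫ x in Ioo (0 : ℝ) 1, f x = F 1 - F 0 := by
  rw [integral_unit_eq, h.eq 1 ⟨zero_le_one, le_rfl⟩]
  ring

theorem add (hF : Prim F f) (hG : Prim G g) :
    Prim (fun x => F x + G x) (fun x => f x + g x) where
  memLp := hF.memLp.add hG.memLp
  eq x hx := by
    rw [intervalIntegral.integral_add (intervalIntegrable_of_integrable hF.integrable hx)
      (intervalIntegrable_of_integrable hG.integrable hx), hF.eq x hx, hG.eq x hx]
    ring

theorem const_mul (hF : Prim F f) (r : ℝ) : Prim (fun x => r * F x) (fun x => r * f x) where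
  memLp := hF.memLp.const_mul r
  eq x hx := by
    rw [intervalIntegral.integral_const_mul, hF.eq x hx]
    ring

theorem sub (hF : Prim F f) (hG : Prim G g) :
    Prim (fun x => F x - G x) (fun x => f x - g x) := by
  simpa [sub_eq_add_neg] using hF.add (hG.const_mul (-1))

theorem mul (hF : Prim F f) (hG : Prim G g) :
    Prim (fun x => F x * G x) (fun x => f x * G x + F x * g x) where
  memLp := by
    refine MemLp.add ?_ (memLp_mul_continuousOn hF.continuousOn hG.memLp)
    simpa [mul_comm] using memLp_mul_continuousOn hG.continuousOn hF.memLp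
  eq x hx := by
    -- F and G are prescribed only on [0,1]; integration by parts is applied to these globally
    -- defined, absolutely continuous versions.
    set F' : ℝ → ℝ := fun x => F 0 + ∫ s in (0 : ℝ)..x, f s with hF'
    set G' : ℝ → ℝ := fun x => G 0 + ∫ s in (0 : ℝ)..x, g s with hG'
    have hfi := intervalIntegrable_of_integrable hF.integrable hx
    have hgi := intervalIntegrable_of_integrable hG.integrable hx
    have hac : ∀ (C : ℝ) (k : ℝ → ℝ), IntervalIntegrable k volume 0 x →
        AbsolutelyContinuousOnInterval (fun x => C + ∫ s in (0 : ℝ)..x, k s) 0 x := by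
      intro C k hk
      have h1 : AbsolutelyContinuousOnInterval (fun _ : ℝ => C) 0 x :=
        (contDiff_const (n := 1)).contDiffOn.absolutelyContinuousOnInterval
      exact h1.add (hk.absolutelyContinuousOnInterval_intervalIntegral left_mem_uIcc)
    have hder : ∀ (C : ℝ) (k : ℝ → ℝ), IntervalIntegrable k volume 0 x →
        ∀ᵐ r, r ∈ uIcc 0 x → deriv (fun x => C + ∫ s in (0 : ℝ)..x, k s) r = k r := by
      intro C k hk
      filter_upwards [hk.ae_hasDerivAt_integral] with r hr hrx
      exact ((hr hrx 0 left_mem_uIcc).const_add C).deriv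
    have key := (hac (F 0) f hfi).integral_deriv_mul_eq_sub (hac (G 0) g hgi)
    have hsub : ∀ r ∈ uIoc 0 x, r ∈ Icc (0 : ℝ) 1 := fun r hr => by
      rw [uIoc_of_le hx.1] at hr
      exact ⟨hr.1.le, hr.2.trans hx.2⟩
    have hcongr : ∫ r in (0 : ℝ)..x, (f r * G r + F r * g r) =
        ∫ r in (0 : ℝ)..x, (deriv F' r * G' r + F' r * deriv G' r) := by
      refine intervalIntegral.integral_congr_ae ?_
      filter_upwards [hder (F 0) f hfi, hder (G 0) g hgi] with r h1 h2 hr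
      rw [hF', hG', h1 (uIoc_subset_uIcc hr), h2 (uIoc_subset_uIcc hr)]
      simp only
      rw [← hF.eq r (hsub r hr), ← hG.eq r (hsub r hr)]
    rw [hcongr, key]
    rw [← hF.eq x hx, ← hG.eq x hx]
    simp

/-- Cauchy–Schwarz on an interval of length at most 1. All the Poincaré and trace inequalities below
come from here. -/
theorem sq_sub_le (h : Prim F f) {x y : ℝ} (hx : x ∈ Icc (0 : ℝ) 1) (hy : y ∈ Icc (0 : ℝ) 1) :
    (F y - F x) ^ 2 ≤ ∫ x in Ioo (0 : ℝ) 1, f x ^ 2 := by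
  refine le_trans ?_ (sq_integral_abs_le h.memLp)
  rw [← sq_abs]
  refine pow_le_pow_left₀ (abs_nonneg _) ?_ 2
  have h1 : F y - F x = ∫ s in x..y, f s := by
    rw [h.eq x hx, h.eq y hy, ← intervalIntegral.integral_interval_sub_left
      (intervalIntegrable_of_integrable h.integrable hy)
      (intervalIntegrable_of_integrable h.integrable hx)]
    ring
  rw [h1]
  refine (intervalIntegral.norm_integral_le_integral_norm_uIoc (f := f) (a := x) (b := y)
    (μ := volume)).trans ?_
  rw [← integral_Ioc_eq_integral_Ioo]
  refine setIntegral_mono_set ?_ (ae_of_all _ fun x => norm_nonneg _) ?_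
  · have := h.integrable.abs
    rwa [IntegrableOn, ← restrict_Ioo_eq_restrict_Ioc]
  · refine LE.le.eventuallyLE fun r hr => ?_
    exact ⟨(le_min hx.1 hy.1).trans_lt hr.1, hr.2.trans (max_le hx.2 hy.2)⟩

end Prim

theorem IsTest.prim {φ : ℝ → ℝ} (h : IsTest φ) : Prim φ (deriv φ) :=
  Prim.of_hasDerivAt (fun x => (h.smooth.differentiable (by simp) x).hasDerivAt)
    (h.smooth.continuous_deriv (by simp))

theorem IsTest.eq_zero {φ : ℝ → ℝ} (h : IsTest φ) {x : ℝ} (hx : x ∉ Ioo (0 : ℝ) 1) : φ x = 0 :=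
  image_eq_zero_of_notMem_tsupport fun h' => hx (h.supp h')

theorem ae_eq_zero_of_integral_test {h : ℝ → ℝ} (hi : Integrable h unitMeasure)
    (h0 : ∀ φ, IsTest φ → ∫ x in Ioo (0 : ℝ) 1, h x * φ x = 0) : h =ᵐ[unitMeasure] 0 := by
  have h1 : ∀ᵐ x ∂volume, x ∈ Ioo (0 : ℝ) 1 → h x = 0 := by
    refine isOpen_Ioo.ae_eq_zero_of_integral_contDiff_smul_eq_zero
      (IntegrableOn.locallyIntegrableOn hi) fun φ hφ hc hs => ?_
    have hT : IsTest φ := ⟨hφ, hc, hs⟩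
    rw [← setIntegral_eq_integral_of_forall_compl_eq_zero (s := Ioo 0 1)]
    · simpa [mul_comm] using h0 φ hT
    · intro x hx
      simp [hT.eq_zero hx]
  exact (ae_restrict_iff' measurableSet_Ioo).2 h1

theorem integrable_mul_continuous {h φ : ℝ → ℝ} (hi : MemLp h 2 unitMeasure)
    (hφ : ContinuousOn φ (Icc 0 1)) : Integrable (fun x => h x * φ x) unitMeasure := by
  have := (memLp_mul_continuousOn hφ hi).integrable one_le_two
  simpa [mul_comm] using this

/-- A test function of vanishing integral is the derivative of a test function. -/
theorem exists_isTest_deriv_eq {θ : ℝ → ℝ} (hs : ContDiff ℝ ∞ θ) {a b : ℝ} (ha : 0 < a)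
    (hb : b < 1) (h0 : ∀ x, x ∉ Icc a b → θ x = 0) (hi : ∫ x in (0 : ℝ)..1, θ x = 0) :
    ∃ φ, IsTest φ ∧ deriv φ = θ := by
  set φ : ℝ → ℝ := fun x => ∫ s in (0 : ℝ)..x, θ s with hφ
  have hder : ∀ x, HasDerivAt φ (θ x) x := fun x =>
    intervalIntegral.integral_hasDerivAt_right (hs.continuous.intervalIntegrable _ _)
      (hs.continuous.stronglyMeasurableAtFilter _ _) hs.continuous.continuousAt
  have hderiv : deriv φ = θ := funext fun x => (hder x).deriv
  have hzero : ∀ x, x ∉ Icc a b → φ x = 0 := by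
    intro x hx
    by_cases hxa : x < a
    · refine (intervalIntegral.integral_congr fun s hs => ?_).trans
        (intervalIntegral.integral_zero (a := 0) (b := x) (μ := volume))
      refine h0 s fun hs' => ?_
      have h2 : s < a := lt_of_le_of_lt hs.2 (max_lt ha hxa)
      exact absurd hs'.1 (not_le.2 h2)
    · have hxb : b < x := by
        by_contra h
        exact hx ⟨not_lt.1 hxa, not_lt.1 h⟩
      have h1 : φ x = φ 1 := by
        rw [hφ, ← sub_eq_zero]
        simp only
        rw [intervalIntegral.integral_interval_sub_left (hs.continuous.intervalIntegrable _ _)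
          (hs.continuous.intervalIntegrable _ _)]
        refine (intervalIntegral.integral_congr fun s hs => ?_).trans
          (intervalIntegral.integral_zero (a := 1) (b := x) (μ := volume))
        refine h0 s fun hs' => ?_
        have h2 : b < s := lt_of_lt_of_le (lt_min hb hxb) hs.1
        exact absurd hs'.2 (not_le.2 h2)
      rw [h1]
      exact hi
  have hsupp : tsupport φ ⊆ Icc a b :=
    closure_minimal (fun x hx => by_contra fun h => hx (hzero x h)) isClosed_Icc
  refine ⟨φ, ⟨?_, HasCompactSupport.intro isCompact_Icc hzero, hsupp.trans fun x hx =>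
    ⟨ha.trans_le hx.1, hx.2.trans_lt hb⟩⟩, hderiv⟩
  rw [contDiff_infty_iff_deriv, hderiv]
  exact ⟨fun x => (hder x).differentiableAt, hs⟩

/-- The du Bois-Reymond lemma on `(0,1)`. -/
theorem exists_ae_eq_const_of_integral_deriv {h : ℝ → ℝ} (hm : MemLp h 2 unitMeasure)
    (h0 : ∀ φ, IsTest φ → ∫ x in Ioo (0 : ℝ) 1, h x * deriv φ x = 0) :
    ∃ C : ℝ, h =ᵐ[unitMeasure] fun _ => C := by
  let B : ContDiffBump (1 / 2 : ℝ) := ⟨1 / 8, 1 / 4, by norm_num, by norm_num⟩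
  set ρ : ℝ → ℝ := B.normed volume with hρ
  have hρs : tsupport ρ = Icc (1 / 4) (3 / 4) := by
    rw [hρ, B.tsupport_normed_eq, Real.closedBall_eq_Icc]
    norm_num [B]
  have hρT : IsTest ρ := ⟨B.contDiff_normed, B.hasCompactSupport_normed, by
    rw [hρs]
    exact fun x hx => ⟨lt_of_lt_of_le (by norm_num) hx.1, lt_of_le_of_lt hx.2 (by norm_num)⟩⟩
  have hρ1 : ∫ x in Ioo (0 : ℝ) 1, ρ x = 1 := by
    rw [setIntegral_eq_integral_of_forall_compl_eq_zero fun x hx => hρT.eq_zero hx]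
    exact B.integral_normed
  have hhi : Integrable h unitMeasure := hm.integrable one_le_two
  set C := ∫ x in Ioo (0 : ℝ) 1, h x * ρ x with hC
  refine ⟨C, ?_⟩
  -- Given a test function ψ of integral m, ψ - mρ has zero integral, hence is φ' for a test
  -- function φ. The hypothesis on φ then says ∫ hψ = mC.
  have key : (fun x => h x - C) =ᵐ[unitMeasure] 0 := by
    refine ae_eq_zero_of_integral_test (hhi.sub (integrable_const C)) fun ψ hψ => ?_
    set m := ∫ x in Ioo (0 : ℝ) 1, ψ x with hmdef
    have hψi : Integrable ψ unitMeasure :=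
      (memLp_of_continuousOn hψ.smooth.continuous.continuousOn).integrable one_le_two
    have hρi : Integrable ρ unitMeasure :=
      (memLp_of_continuousOn hρT.smooth.continuous.continuousOn).integrable one_le_two
    set K := tsupport ψ ∪ tsupport ρ with hK
    have hKc : IsCompact K := hψ.compact.isCompact.union hρT.compact.isCompact
    have hKne : K.Nonempty := ⟨1 / 2, Or.inr (by rw [hρs]; norm_num)⟩
    have hKs : K ⊆ Ioo 0 1 := union_subset hψ.supp hρT.supp
    have hKI : K ⊆ Icc (sInf K) (sSup K) := fun x hx =>
      ⟨csInf_le hKc.bddBelow hx, le_csSup hKc.bddAbove hx⟩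
    obtain ⟨φ, hφ, hφd⟩ := exists_isTest_deriv_eq (θ := fun x => ψ x - m * ρ x)
      (hψ.smooth.sub (contDiff_const.mul hρT.smooth))
      (hKs (hKc.sInf_mem hKne)).1 (hKs (hKc.sSup_mem hKne)).2
      (fun x hx => by
        have hxK : x ∉ K := fun h => hx (hKI h)
        rw [image_eq_zero_of_notMem_tsupport fun h => hxK (Or.inl h),
          image_eq_zero_of_notMem_tsupport fun h => hxK (Or.inr h)]
        simp)
      (by
        rw [← integral_unit_eq, integral_sub hψi (hρi.const_mul m), integral_const_mul, hρ1]
        simp [hmdef])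
    have h1 := h0 φ hφ
    rw [hφd] at h1
    have hhψ := integrable_mul_continuous hm hψ.smooth.continuous.continuousOn
    have hhρ := integrable_mul_continuous hm hρT.smooth.continuous.continuousOn
    have h2 : ∫ x in Ioo (0 : ℝ) 1, h x * (ψ x - m * ρ x) =
        (∫ x in Ioo (0 : ℝ) 1, h x * ψ x) - m * C := by
      simp only [mul_sub, mul_left_comm _ m]
      rw [integral_sub hhψ (hhρ.const_mul m), integral_const_mul]
    have h3 : ∫ x in Ioo (0 : ℝ) 1, (h x - C) * ψ x =
        (∫ x in Ioo (0 : ℝ) 1, h x * ψ x) - C * m := by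
      simp only [sub_mul]
      rw [integral_sub hhψ (hψi.const_mul C), integral_const_mul]
    rw [h3]
    linarith
  filter_upwards [key] with x hx
  exact sub_eq_zero.1 hx

/-- Subtracting the primitive of g leaves a function with weak derivative zero, which is constant by
du Bois-Reymond; the converse is integration by parts. -/
theorem hasWeakDeriv_iff {f g : L2} :
    HasWeakDeriv f g ↔ ∃ F, Prim F g ∧ f =ᵐ[unitMeasure] F := by
  constructor
  · intro h
    have hP := Prim.of_integral (Lp.memLp g) 0
    set F : ℝ → ℝ := fun x => 0 + ∫ s in (0 : ℝ)..x, g s with hF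
    obtain ⟨C, hC⟩ := exists_ae_eq_const_of_integral_deriv
      (h := fun x => f x - F x) ((Lp.memLp f).sub hP.memLp_left) (fun φ hφ => by
        have h1 := (hP.mul hφ.prim).integral_eq
        rw [hφ.eq_zero (x := 1) (by simp), hφ.eq_zero (x := 0) (by simp),
          integral_add (integrable_mul_continuous hP.memLp hφ.prim.continuousOn)
            (integrable_mul_continuous hP.memLp_left
              (hφ.smooth.continuous_deriv (by simp)).continuousOn)] at h1
        have h2 := h φ hφ
        simp only [sub_mul]
        rw [integral_sub (integrable_mul_continuous (Lp.memLp f)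
            (hφ.smooth.continuous_deriv (by simp)).continuousOn)
            (integrable_mul_continuous hP.memLp_left
              (hφ.smooth.continuous_deriv (by simp)).continuousOn)]
        linarith)
    refine ⟨_, Prim.of_integral (Lp.memLp g) C, ?_⟩
    filter_upwards [hC] with x hx
    simp only [hF] at hx
    linarith
  · rintro ⟨F, hP, hfF⟩ φ hφ
    have h1 := (hP.mul hφ.prim).integral_eq
    rw [hφ.eq_zero (x := 1) (by simp), hφ.eq_zero (x := 0) (by simp),
      integral_add (integrable_mul_continuous hP.memLp hφ.prim.continuousOn)
        (integrable_mul_continuous hP.memLp_left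
          (hφ.smooth.continuous_deriv (by simp)).continuousOn)] at h1
    have h2 : ∫ x in Ioo (0 : ℝ) 1, f x * deriv φ x = ∫ x in Ioo (0 : ℝ) 1, F x * deriv φ x := by
      refine integral_congr_ae ?_
      filter_upwards [hfF] with x hx
      rw [hx]
    rw [h2]
    linarith

theorem HasWeakDeriv.unique {f g g' : L2} (h : HasWeakDeriv f g) (h' : HasWeakDeriv f g') :
    g = g' := by
  refine Lp.ext ((sub_ae_eq_zero _ _).1 ?_)
  refine ae_eq_zero_of_integral_test
    (((Lp.memLp g).sub (Lp.memLp g')).integrable one_le_two) fun φ hφ => ?_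
  have h1 := (h φ hφ).symm.trans (h' φ hφ)
  simp only [Pi.sub_apply, sub_mul]
  rw [integral_sub (integrable_mul_continuous (Lp.memLp g) hφ.prim.continuousOn)
    (integrable_mul_continuous (Lp.memLp g') hφ.prim.continuousOn)]
  linarith

theorem HasTrace.eq_of_ae_eq {f : L2} {x y : ℝ} (h : HasTrace f x y) (hx : x ∈ Icc (0 : ℝ) 1)
    {F : ℝ → ℝ} (hF : ContinuousOn F (Icc 0 1)) (hfF : f =ᵐ[unitMeasure] F) : F x = y := by
  obtain ⟨F', hF', hfF', hy⟩ := h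
  rw [← hy]
  exact eqOn_of_ae_eq_unit hF hF' (hfF.symm.trans hfF') hx

theorem HasTrace.of_ae_eq {f : L2} {F : ℝ → ℝ} (hF : ContinuousOn F (Icc 0 1))
    (hfF : f =ᵐ[unitMeasure] F) (x : ℝ) : HasTrace f x (F x) := ⟨F, hF, hfF, rfl⟩

/-! ### The generator in terms of pointwise representatives, and the phase space. -/

/-- Continuous representatives of the components of `Y ∈ D(A_ε)` and of `Z = A_ε Y`. -/
structure IsProfile (a b c d ε : ℝ) (Y Z : State) (U Ux Uxx V Vx P Px Pxx : ℝ → ℝ) : Prop where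
  primU : Prim U Ux
  primUx : Prim Ux Uxx
  primV : Prim V Vx
  primP : Prim P Px
  primPx : Prim Px Pxx
  u_zero : U 0 = 0
  v_zero : V 0 = 0
  ux_one : Ux 1 = -a * V 1 + b * P 0
  px_zero : Px 0 = c * P 0
  px_one : Px 1 = d * U 1
  u_eq : Y.u =ᵐ[unitMeasure] U
  ux_eq : Y.ux =ᵐ[unitMeasure] Ux
  v_eq : Y.v =ᵐ[unitMeasure] V
  p_eq : Y.p =ᵐ[unitMeasure] P
  zu_eq : Z.u =ᵐ[unitMeasure] V
  zux_eq : Z.ux =ᵐ[unitMeasure] Vx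
  zv_eq : Z.v =ᵐ[unitMeasure] Uxx
  zp_eq : Z.p =ᵐ[unitMeasure] fun x => ε⁻¹ * Pxx x

theorem State.hasWeakDeriv_u (Y : State) : HasWeakDeriv Y.u Y.ux := Y.fst.2

theorem one_mem_unit : (1 : ℝ) ∈ Icc (0 : ℝ) 1 := ⟨zero_le_one, le_rfl⟩

theorem zero_mem_unit : (0 : ℝ) ∈ Icc (0 : ℝ) 1 := ⟨le_rfl, zero_le_one⟩

theorem isGenerator_iff_exists_isProfile {a b c d ε : ℝ} {Y Z : State} :
    IsGenerator a b c d ε Y Z ↔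
      ∃ U Ux Uxx V Vx P Px Pxx, IsProfile a b c d ε Y Z U Ux Uxx V Vx P Px Pxx := by
  constructor
  · rintro ⟨uxx, px, pxx, hux, hp, hpx, hZu, hZv, hZp, u1, ux1, v1, p0, px0, px1, tu1, tux1, tv1,
      tp0, tpx0, tpx1, tu0, tv0, e1, e2, e3⟩
    obtain ⟨U, hU, hUe⟩ := hasWeakDeriv_iff.1 Y.hasWeakDeriv_u
    obtain ⟨Ux, hUx, hUxe⟩ := hasWeakDeriv_iff.1 hux
    obtain ⟨V, hV, hVe⟩ := hasWeakDeriv_iff.1 Z.hasWeakDeriv_u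
    obtain ⟨P, hP, hPe⟩ := hasWeakDeriv_iff.1 hp
    obtain ⟨Px, hPx, hPxe⟩ := hasWeakDeriv_iff.1 hpx
    have hVe' : Y.v =ᵐ[unitMeasure] V := by rwa [← hZu]
    refine ⟨U, Ux, uxx, V, Z.ux, P, Px, pxx, hU.congr (fun _ _ => rfl) hUxe, hUx, hV,
      hP.congr (fun _ _ => rfl) hPxe, hPx, ?_, ?_, ?_, ?_, ?_, hUe, hUxe, hVe', hPe, hVe,
      ae_eq_refl _, ?_, ?_⟩
    · exact tu0.eq_of_ae_eq zero_mem_unit hU.continuousOn hUe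
    · exact tv0.eq_of_ae_eq zero_mem_unit hV.continuousOn hVe'
    · rw [tux1.eq_of_ae_eq one_mem_unit hUx.continuousOn hUxe,
        tv1.eq_of_ae_eq one_mem_unit hV.continuousOn hVe',
        tp0.eq_of_ae_eq zero_mem_unit hP.continuousOn hPe, e1]
    · rw [tpx0.eq_of_ae_eq zero_mem_unit hPx.continuousOn hPxe,
        tp0.eq_of_ae_eq zero_mem_unit hP.continuousOn hPe, e2]
    · rw [tpx1.eq_of_ae_eq one_mem_unit hPx.continuousOn hPxe,
        tu1.eq_of_ae_eq one_mem_unit hU.continuousOn hUe, e3]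
    · rw [hZv]
    · rw [hZp]
      filter_upwards [Lp.coeFn_smul ε⁻¹ pxx] with x hx
      simp [hx]
  · rintro ⟨U, Ux, Uxx, V, Vx, P, Px, Pxx, h⟩
    have hpx := h.primPx.memLp_left.coeFn_toLp
    have hpxx := h.primPx.memLp.coeFn_toLp
    refine ⟨Z.v, h.primPx.memLp_left.toLp Px, h.primPx.memLp.toLp Pxx,
      hasWeakDeriv_iff.2 ⟨Ux, h.primUx.congr (fun _ _ => rfl) h.zv_eq.symm, h.ux_eq⟩,
      hasWeakDeriv_iff.2 ⟨P, h.primP.congr (fun _ _ => rfl) hpx.symm, h.p_eq⟩,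
      hasWeakDeriv_iff.2 ⟨Px, h.primPx.congr (fun _ _ => rfl) hpxx.symm, hpx⟩,
      Lp.ext (h.zu_eq.trans h.v_eq.symm), rfl, Lp.ext ?_, U 1, Ux 1, V 1, P 0, Px 0, Px 1,
      .of_ae_eq h.primU.continuousOn h.u_eq _, .of_ae_eq h.primUx.continuousOn h.ux_eq _,
      .of_ae_eq h.primV.continuousOn h.v_eq _, .of_ae_eq h.primP.continuousOn h.p_eq _,
      .of_ae_eq h.primPx.continuousOn hpx _, .of_ae_eq h.primPx.continuousOn hpx _,
      ?_, ?_, h.ux_one, h.px_zero, h.px_one⟩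
    · filter_upwards [h.zp_eq, Lp.coeFn_smul ε⁻¹ (h.primPx.memLp.toLp Pxx), hpxx] with x h1 h2 h3
      rw [h1, h2, Pi.smul_apply, h3, smul_eq_mul]
    · simpa only [h.u_zero] using HasTrace.of_ae_eq h.primU.continuousOn h.u_eq 0
    · simpa only [h.v_zero] using HasTrace.of_ae_eq h.primV.continuousOn h.v_eq 0

/-- The displacement component as a continuous linear map. -/
def uL : State →L[ℝ] L2 :=
  WithLp.fstL 2 ℝ L2 L2 ∘L H1.subtypeL ∘L WithLp.fstL 2 ℝ H1 (WithLp 2 (L2 × L2))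

/-- The derivative of the displacement component as a continuous linear map. -/
def uxL : State →L[ℝ] L2 :=
  WithLp.sndL 2 ℝ L2 L2 ∘L H1.subtypeL ∘L WithLp.fstL 2 ℝ H1 (WithLp 2 (L2 × L2))

/-- The velocity component as a continuous linear map. -/
def vL : State →L[ℝ] L2 :=
  WithLp.fstL 2 ℝ L2 L2 ∘L WithLp.sndL 2 ℝ H1 (WithLp 2 (L2 × L2))

/-- The temperature component as a continuous linear map. -/
def pL : State →L[ℝ] L2 :=
  WithLp.sndL 2 ℝ L2 L2 ∘L WithLp.sndL 2 ℝ H1 (WithLp 2 (L2 × L2))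

theorem uL_apply (Y : State) : uL Y = Y.u := rfl
theorem uxL_apply (Y : State) : uxL Y = Y.ux := rfl

theorem State.ext_components {Y Z : State} (hu : Y.u = Z.u) (hv : Y.v = Z.v) (hp : Y.p = Z.p) :
    Y = Z := by
  have hux : Y.ux = Z.ux := by
    have := Y.hasWeakDeriv_u
    rw [hu] at this
    exact this.unique Z.hasWeakDeriv_u
  have h1 : Y.fst = Z.fst := Subtype.ext (WithLp.ofLp_injective 2 (Prod.ext hu hux))
  have h2 : Y.snd = Z.snd := WithLp.ofLp_injective 2 (Prod.ext hv hp)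
  exact WithLp.ofLp_injective 2 (Prod.ext h1 h2)

theorem State.norm_sq (Y : State) :
    ‖Y‖ ^ 2 = ‖Y.u‖ ^ 2 + ‖Y.ux‖ ^ 2 + ‖Y.v‖ ^ 2 + ‖Y.p‖ ^ 2 := by
  rw [WithLp.prod_norm_sq_eq_of_L2, WithLp.prod_norm_sq_eq_of_L2 Y.snd]
  have : ‖Y.fst‖ ^ 2 = ‖Y.fst.1.fst‖ ^ 2 + ‖Y.fst.1.snd‖ ^ 2 := WithLp.prod_norm_sq_eq_of_L2 Y.fst.1
  rw [this]
  simp only [State.u, State.ux, State.v, State.p]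
  ring

theorem exists_state {U Ux V P : ℝ → ℝ} (hU : Prim U Ux) (hV : MemLp V 2 unitMeasure)
    (hP : MemLp P 2 unitMeasure) :
    ∃ Y : State, Y.u =ᵐ[unitMeasure] U ∧ Y.ux =ᵐ[unitMeasure] Ux ∧ Y.v =ᵐ[unitMeasure] V ∧
      Y.p =ᵐ[unitMeasure] P :=
  ⟨WithLp.toLp 2 (⟨WithLp.toLp 2 (hU.memLp_left.toLp U, hU.memLp.toLp Ux),
      hasWeakDeriv_iff.2 ⟨U, hU.congr (fun _ _ => rfl) hU.memLp.coeFn_toLp.symm,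
        hU.memLp_left.coeFn_toLp⟩⟩, WithLp.toLp 2 (hV.toLp V, hP.toLp P)),
    hU.memLp_left.coeFn_toLp, hU.memLp.coeFn_toLp, hV.coeFn_toLp, hP.coeFn_toLp⟩

theorem inner_L2_eq {f g : L2} {F G : ℝ → ℝ} (hf : f =ᵐ[unitMeasure] F)
    (hg : g =ᵐ[unitMeasure] G) : inner ℝ f g = ∫ x in Ioo (0 : ℝ) 1, F x * G x := by
  rw [L2.inner_def]
  refine integral_congr_ae ?_
  filter_upwards [hf, hg] with x h1 h2
  simp [h1, h2, mul_comm]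

theorem norm_sq_L2_eq {f : L2} {F : ℝ → ℝ} (hf : f =ᵐ[unitMeasure] F) :
    ‖f‖ ^ 2 = ∫ x in Ioo (0 : ℝ) 1, F x ^ 2 := by
  rw [← real_inner_self_eq_norm_sq, inner_L2_eq hf hf]
  simp [sq]

/-- The trace at `0` of the displacement component. -/
def traceZero : State →L[ℝ] ℝ :=
  innerSL ℝ ((memLp_of_continuousOn (F := fun _ => 1) continuousOn_const).toLp _ : L2) ∘L uL +
  innerSL ℝ ((memLp_of_continuousOn (F := fun x => x - 1)
    (continuousOn_id.sub continuousOn_const)).toLp _ : L2) ∘L uxL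

/-- Integrating ((x - 1)U)' over (0,1) gives U(0) = ∫ U + ∫ (x - 1)U', which exhibits the trace as a
bounded functional. -/
theorem traceZero_eq {Y : State} {U Ux : ℝ → ℝ} (hU : Prim U Ux) (hu : Y.u =ᵐ[unitMeasure] U)
    (hux : Y.ux =ᵐ[unitMeasure] Ux) : traceZero Y = U 0 := by
  have hX : Prim (fun x => x - 1) (fun _ => 1) :=
    Prim.of_hasDerivAt (fun x => (hasDerivAt_id x).sub_const 1) continuous_const
  have h := (hX.mul hU).integral_eq
  rw [integral_add (by simpa using hU.memLp_left.integrable one_le_two)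
    ((memLp_mul_continuousOn hX.continuousOn hU.memLp).integrable one_le_two)] at h
  simp only [traceZero, add_apply, ContinuousLinearMap.comp_apply,
    innerSL_apply_apply, uL_apply, uxL_apply]
  rw [inner_L2_eq (MemLp.coeFn_toLp _) hu, inner_L2_eq (MemLp.coeFn_toLp _) hux, h]
  simp

theorem traceZero_eq_zero_iff {Y : State} : traceZero Y = 0 ↔ HasTrace Y.u 0 0 := by
  obtain ⟨U, hU, hUe⟩ := hasWeakDeriv_iff.1 Y.hasWeakDeriv_u
  rw [traceZero_eq hU hUe (ae_eq_refl _)]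
  refine ⟨fun h => ?_, fun h => h.eq_of_ae_eq zero_mem_unit hU.continuousOn hUe⟩
  simpa only [h] using HasTrace.of_ae_eq hU.continuousOn hUe 0

/-- The phase space: states whose displacement vanishes at `0`. -/
abbrev Phase : Submodule ℝ State := traceZero.ker

instance : NormedAddCommGroup Phase := Submodule.normedAddCommGroup _

instance : NormedSpace ℝ Phase := Submodule.normedSpace _

instance : CompleteSpace Phase := traceZero.isClosed_ker.completeSpace_coe

theorem Phase.norm_eq (Y : Phase) : ‖Y‖ = ‖(Y : State)‖ := rfl

theorem mem_phase_iff {Y : State} : Y ∈ Phase ↔ HasTrace Y.u 0 0 := traceZero_eq_zero_iff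

/-- The condition v(0) = 0 is the trace condition on the displacement of A_ε Y. Hence A_ε acts
within the phase space, and mild solutions starting there stay there. -/
theorem IsProfile.mem_phase {a b c d ε : ℝ} {Y Z : State} {U Ux Uxx V Vx P Px Pxx : ℝ → ℝ}
    (h : IsProfile a b c d ε Y Z U Ux Uxx V Vx P Px Pxx) : Y ∈ Phase ∧ Z ∈ Phase := by
  constructor
  · exact (traceZero_eq h.primU h.u_eq h.ux_eq).trans h.u_zero
  · exact (traceZero_eq h.primV h.zu_eq h.zux_eq).trans h.v_zero

theorem IsProfile.add {a b c d ε : ℝ} {Y Z Y' Z' : State} {U Ux Uxx V Vx P Px Pxx : ℝ → ℝ}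
    {U' Ux' Uxx' V' Vx' P' Px' Pxx' : ℝ → ℝ}
    (h : IsProfile a b c d ε Y Z U Ux Uxx V Vx P Px Pxx)
    (h' : IsProfile a b c d ε Y' Z' U' Ux' Uxx' V' Vx' P' Px' Pxx') :
    IsProfile a b c d ε (Y + Y') (Z + Z') (fun x => U x + U' x) (fun x => Ux x + Ux' x)
      (fun x => Uxx x + Uxx' x) (fun x => V x + V' x) (fun x => Vx x + Vx' x)
      (fun x => P x + P' x) (fun x => Px x + Px' x) (fun x => Pxx x + Pxx' x) := by
  have key : ∀ {f f' : L2} {F F' : ℝ → ℝ}, f =ᵐ[unitMeasure] F → f' =ᵐ[unitMeasure] F' →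
      (f + f' : L2) =ᵐ[unitMeasure] fun x => F x + F' x := by
    intro f f' F F' h1 h2
    filter_upwards [Lp.coeFn_add f f', h1, h2] with x e1 e2 e3
    rw [e1, Pi.add_apply, e2, e3]
  refine ⟨h.primU.add h'.primU, h.primUx.add h'.primUx, h.primV.add h'.primV,
    h.primP.add h'.primP, h.primPx.add h'.primPx, ?_, ?_, ?_, ?_, ?_, key h.u_eq h'.u_eq,
    key h.ux_eq h'.ux_eq, key h.v_eq h'.v_eq, key h.p_eq h'.p_eq, key h.zu_eq h'.zu_eq,
    key h.zux_eq h'.zux_eq, key h.zv_eq h'.zv_eq, ?_⟩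
  · rw [h.u_zero, h'.u_zero, add_zero]
  · rw [h.v_zero, h'.v_zero, add_zero]
  · rw [h.ux_one, h'.ux_one]; ring
  · rw [h.px_zero, h'.px_zero]; ring
  · rw [h.px_one, h'.px_one]; ring
  · simp only [mul_add]
    exact key h.zp_eq h'.zp_eq

theorem IsProfile.smul {a b c d ε : ℝ} {Y Z : State} {U Ux Uxx V Vx P Px Pxx : ℝ → ℝ}
    (h : IsProfile a b c d ε Y Z U Ux Uxx V Vx P Px Pxx) (r : ℝ) :
    IsProfile a b c d ε (r • Y) (r • Z) (fun x => r * U x) (fun x => r * Ux x)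
      (fun x => r * Uxx x) (fun x => r * V x) (fun x => r * Vx x)
      (fun x => r * P x) (fun x => r * Px x) (fun x => r * Pxx x) := by
  have key : ∀ {f : L2} {F : ℝ → ℝ}, f =ᵐ[unitMeasure] F →
      (r • f : L2) =ᵐ[unitMeasure] fun x => r * F x := by
    intro f F h1
    filter_upwards [Lp.coeFn_smul r f, h1] with x e1 e2
    rw [e1, Pi.smul_apply, e2, smul_eq_mul]
  refine ⟨h.primU.const_mul r, h.primUx.const_mul r, h.primV.const_mul r,
    h.primP.const_mul r, h.primPx.const_mul r, ?_, ?_, ?_, ?_, ?_, key h.u_eq,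
    key h.ux_eq, key h.v_eq, key h.p_eq, key h.zu_eq, key h.zux_eq, key h.zv_eq, ?_⟩
  · rw [h.u_zero, mul_zero]
  · rw [h.v_zero, mul_zero]
  · rw [h.ux_one]; ring
  · rw [h.px_zero]; ring
  · rw [h.px_one]; ring
  · simp only [mul_left_comm]
    exact key h.zp_eq

theorem IsGenerator.eq_zero {a b c d ε : ℝ} {Z : State} (h : IsGenerator a b c d ε 0 Z) :
    Z = 0 := by
  have h0 : HasWeakDeriv 0 0 := H1.zero_mem
  obtain ⟨uxx, px, pxx, hux, hp, hpx, hZu, hZv, hZp, -⟩ := h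
  have e1 : uxx = 0 := HasWeakDeriv.unique hux h0
  have e2 : px = 0 := HasWeakDeriv.unique hp h0
  rw [e2] at hpx
  have e3 : pxx = 0 := HasWeakDeriv.unique hpx h0
  refine State.ext_components hZu (hZv.trans e1) ?_
  rw [hZp, e3, smul_zero]
  rfl

/-- The graph of `A_ε` in the phase space. -/
def generator (a b c d ε : ℝ) : Submodule ℝ (Phase × Phase) where
  carrier := {q | IsGenerator a b c d ε q.1 q.2}
  zero_mem' := by
    refine isGenerator_iff_exists_isProfile.2 ⟨0, 0, 0, 0, 0, 0, 0, 0, ?_⟩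
    have hP : Prim 0 0 := Prim.of_hasDerivAt (fun x => hasDerivAt_const x 0) continuous_const
    have h0 : ((0 : L2) : ℝ → ℝ) =ᵐ[unitMeasure] 0 := Lp.coeFn_zero ℝ 2 unitMeasure
    have h1 : ((0 : L2) : ℝ → ℝ) =ᵐ[unitMeasure] fun x => ε⁻¹ * (0 : ℝ → ℝ) x := by
      simp only [Pi.zero_apply, mul_zero]
      exact h0
    exact ⟨hP, hP, hP, hP, hP, rfl, rfl, by simp, by simp, by simp, h0, h0, h0, h0, h0, h0, h0, h1⟩
  add_mem' := by
    intro q q' h h'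
    obtain ⟨_, _, _, _, _, _, _, _, h⟩ := isGenerator_iff_exists_isProfile.1 h
    obtain ⟨_, _, _, _, _, _, _, _, h'⟩ := isGenerator_iff_exists_isProfile.1 h'
    exact isGenerator_iff_exists_isProfile.2 ⟨_, _, _, _, _, _, _, _, h.add h'⟩
  smul_mem' := by
    intro r q h
    obtain ⟨_, _, _, _, _, _, _, _, h⟩ := isGenerator_iff_exists_isProfile.1 h
    exact isGenerator_iff_exists_isProfile.2 ⟨_, _, _, _, _, _, _, _, h.smul r⟩

theorem mem_generator {a b c d ε : ℝ} {x y : Phase} :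
    (x, y) ∈ generator a b c d ε ↔ IsGenerator a b c d ε x y := Iff.rfl

/-! ### Weighted Riemann coordinates and the equivalent norm. -/

theorem memLp_top_exp (k : ℝ) : MemLp (fun x : ℝ => Real.exp (k * x)) ⊤ unitMeasure := by
  have hc : ContinuousOn (fun x : ℝ => Real.exp (k * x)) (Icc 0 1) := by fun_prop
  obtain ⟨C, hC⟩ := isCompact_Icc.exists_bound_of_continuousOn hc
  refine memLp_top_of_bound (by fun_prop) C ?_
  filter_upwards [ae_restrict_mem measurableSet_Ioo] with x hx
    using hC x (Ioo_subset_Icc_self hx)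

/-- Multiplication by `exp (k x)` on `L²(0,1)`. -/
def mulExp (k : ℝ) : L2 →L[ℝ] L2 :=
  (ContinuousLinearMap.mul ℝ ℝ).holderL unitMeasure ⊤ 2 2 ((memLp_top_exp k).toLp _)

theorem coeFn_mulExp (k : ℝ) (f : L2) :
    mulExp k f =ᵐ[unitMeasure] fun x => Real.exp (k * x) * f x := by
  filter_upwards [(ContinuousLinearMap.mul ℝ ℝ).coeFn_holder (r := 2) ((memLp_top_exp k).toLp _) f,
    (memLp_top_exp k).coeFn_toLp] with x h1 h2
  exact h1.trans (by simp [h2])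

theorem mulExp_neg_mulExp (k : ℝ) (f : L2) : mulExp (-k) (mulExp k f) = f := by
  refine Lp.ext ?_
  filter_upwards [coeFn_mulExp (-k) (mulExp k f), coeFn_mulExp k f] with x h1 h2
  rw [h1, h2, ← mul_assoc, ← Real.exp_add]
  simp

theorem norm_le_mulExp (k : ℝ) (f : L2) : ‖f‖ ≤ ‖mulExp (-k)‖ * ‖mulExp k f‖ := by
  conv_lhs => rw [← mulExp_neg_mulExp k f]
  exact (mulExp (-k)).le_opNorm _

theorem inner_mulExp {f g : L2} {F G : ℝ → ℝ} (k : ℝ) (hf : f =ᵐ[unitMeasure] F)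
    (hg : g =ᵐ[unitMeasure] G) : inner ℝ (mulExp (k / 2) f) (mulExp (k / 2) g) =
      ∫ x in Ioo (0 : ℝ) 1, Real.exp (k * x) * (F x * G x) := by
  rw [inner_L2_eq (coeFn_mulExp _ f) (coeFn_mulExp _ g)]
  refine integral_congr_ae ?_
  filter_upwards [hf, hg] with x h1 h2
  rw [h1, h2, mul_mul_mul_comm, ← Real.exp_add]
  ring_nf

/-- Target of the weighted Riemann coordinates. -/
abbrev RiemannSpace : Type := WithLp 2 (L2 × WithLp 2 (L2 × L2))

/-- The weighted Riemann coordinates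
`(exp (m x / 2) (v + u_x), exp (-m x / 2) (v - u_x), r p)`. -/
def riemann (m r : ℝ) : State →L[ℝ] RiemannSpace :=
  ((WithLp.prodContinuousLinearEquiv 2 ℝ L2 (WithLp 2 (L2 × L2))).symm :
      L2 × WithLp 2 (L2 × L2) →L[ℝ] RiemannSpace) ∘L
    ((mulExp (m / 2) ∘L (vL + uxL)).prod
      (((WithLp.prodContinuousLinearEquiv 2 ℝ L2 L2).symm : L2 × L2 →L[ℝ] WithLp 2 (L2 × L2)) ∘L
        ((mulExp (-m / 2) ∘L (vL - uxL)).prod (r • pL))))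

theorem inner_riemann (m r : ℝ) (Y Z : State) :
    inner ℝ (riemann m r Y) (riemann m r Z) =
      inner ℝ (mulExp (m / 2) (Y.v + Y.ux)) (mulExp (m / 2) (Z.v + Z.ux)) +
      (inner ℝ (mulExp (-m / 2) (Y.v - Y.ux)) (mulExp (-m / 2) (Z.v - Z.ux)) +
        r ^ 2 * inner ℝ Y.p Z.p) := by
  rw [WithLp.prod_inner_apply, WithLp.prod_inner_apply]
  have : inner ℝ (r • Y.p) (r • Z.p) = r ^ 2 * inner ℝ Y.p Z.p := by
    rw [real_inner_smul_left, real_inner_smul_right]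
    ring
  rw [← this]
  rfl

theorem norm_sq_riemann (m r : ℝ) (Y : State) :
    ‖riemann m r Y‖ ^ 2 = ‖mulExp (m / 2) (Y.v + Y.ux)‖ ^ 2 +
      (‖mulExp (-m / 2) (Y.v - Y.ux)‖ ^ 2 + r ^ 2 * ‖Y.p‖ ^ 2) := by
  simp only [← real_inner_self_eq_norm_sq]
  exact inner_riemann m r Y Y

/-- Poincaré's inequality. It is needed because the Riemann coordinates see u only through u_x. -/
theorem norm_u_le_of_mem_phase {Y : State} (hY : Y ∈ Phase) : ‖Y.u‖ ≤ ‖Y.ux‖ := by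
  obtain ⟨U, hU, hUe⟩ := hasWeakDeriv_iff.1 Y.hasWeakDeriv_u
  have h0 : U 0 = 0 := (traceZero_eq hU hUe (ae_eq_refl _)).symm.trans hY
  refine (pow_le_pow_iff_left₀ (norm_nonneg _) (norm_nonneg _) two_ne_zero).1 ?_
  rw [norm_sq_L2_eq hUe, norm_sq_L2_eq (ae_eq_refl Y.ux)]
  have h1 : ∫ x in Ioo (0 : ℝ) 1, U x ^ 2 ≤
      ∫ _ in Ioo (0 : ℝ) 1, (∫ s in Ioo (0 : ℝ) 1, Y.ux s ^ 2) := by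
    refine setIntegral_mono_on hU.memLp_left.integrable_sq (integrable_const _) measurableSet_Ioo
      fun x hx => ?_
    have := hU.sq_sub_le zero_mem_unit (Ioo_subset_Icc_self hx)
    rwa [h0, sub_zero] at this
  simpa using h1

theorem exists_norm_le_riemann (m : ℝ) {r : ℝ} (hr : 0 < r) :
    ∃ C : ℝ, 0 ≤ C ∧ ∀ Y ∈ Phase, ‖Y‖ ≤ C * ‖riemann m r Y‖ := by
  set N₁ := ‖mulExp (-(m / 2))‖
  set N₂ := ‖mulExp (-(-m / 2))‖
  refine ⟨3 * (N₁ + N₂) + r⁻¹, by positivity, fun Y hY => ?_⟩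
  set R := ‖riemann m r Y‖ with hR
  have hsq := norm_sq_riemann m r Y
  have hw0 := norm_nonneg (mulExp (m / 2) (Y.v + Y.ux))
  have hz0 := norm_nonneg (mulExp (-m / 2) (Y.v - Y.ux))
  have hp0 : 0 ≤ r * ‖Y.p‖ := by positivity
  have hw : ‖mulExp (m / 2) (Y.v + Y.ux)‖ ≤ R := by
    refine (pow_le_pow_iff_left₀ hw0 (norm_nonneg _) two_ne_zero).1 ?_
    nlinarith
  have hz : ‖mulExp (-m / 2) (Y.v - Y.ux)‖ ≤ R := by
    refine (pow_le_pow_iff_left₀ hz0 (norm_nonneg _) two_ne_zero).1 ?_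
    nlinarith
  have hp : r * ‖Y.p‖ ≤ R := by
    refine (pow_le_pow_iff_left₀ hp0 (norm_nonneg _) two_ne_zero).1 ?_
    nlinarith
  have hw' : ‖Y.v + Y.ux‖ ≤ N₁ * R :=
    (norm_le_mulExp (m / 2) _).trans (mul_le_mul_of_nonneg_left hw (norm_nonneg _))
  have hz' : ‖Y.v - Y.ux‖ ≤ N₂ * R :=
    (norm_le_mulExp (-m / 2) _).trans (mul_le_mul_of_nonneg_left hz (norm_nonneg _))
  have hp' : ‖Y.p‖ ≤ r⁻¹ * R := by
    rw [inv_mul_eq_div, le_div_iff₀ hr]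
    linarith
  have hv : ‖Y.v‖ ≤ (N₁ + N₂) * R := by
    have h1 : (2 : ℝ) • Y.v = (Y.v + Y.ux) + (Y.v - Y.ux) := by rw [two_smul]; abel
    have h2 : 2 * ‖Y.v‖ ≤ ‖Y.v + Y.ux‖ + ‖Y.v - Y.ux‖ := by
      have := norm_add_le (Y.v + Y.ux) (Y.v - Y.ux)
      rw [← h1, norm_smul] at this
      simpa using this
    linarith [norm_nonneg Y.v]
  have hux : ‖Y.ux‖ ≤ (N₁ + N₂) * R := by
    have h1 : (2 : ℝ) • Y.ux = (Y.v + Y.ux) - (Y.v - Y.ux) := by rw [two_smul]; abel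
    have h2 : 2 * ‖Y.ux‖ ≤ ‖Y.v + Y.ux‖ + ‖Y.v - Y.ux‖ := by
      have := norm_sub_le (Y.v + Y.ux) (Y.v - Y.ux)
      rw [← h1, norm_smul] at this
      simpa using this
    linarith [norm_nonneg Y.ux]
  have hu := norm_u_le_of_mem_phase hY
  have hY4 : ‖Y‖ ≤ ‖Y.u‖ + ‖Y.ux‖ + ‖Y.v‖ + ‖Y.p‖ := by
    refine (pow_le_pow_iff_left₀ (norm_nonneg _) (by positivity) two_ne_zero).1 ?_
    rw [State.norm_sq]
    have a1 := norm_nonneg Y.u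
    have a2 := norm_nonneg Y.ux
    have a3 := norm_nonneg Y.v
    have a4 := norm_nonneg Y.p
    nlinarith [mul_nonneg a1 a2, mul_nonneg a1 a3, mul_nonneg a1 a4, mul_nonneg a2 a3,
      mul_nonneg a2 a4, mul_nonneg a3 a4]
  linarith

/-! ### The Lyapunov identity. -/

/-- The energy identity for the weighted Riemann coordinates. -/
theorem Prim.two_mul_integral_exp {W w : ℝ → ℝ} (h : Prim W w) (k : ℝ) :
    2 * ∫ x in Ioo (0 : ℝ) 1, Real.exp (k * x) * (w x * W x) =
      Real.exp k * W 1 ^ 2 - W 0 ^ 2 - k * ∫ x in Ioo (0 : ℝ) 1, Real.exp (k * x) * (W x * W x) := by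
  have hE : Prim (fun x => Real.exp (k * x)) (fun x => k * Real.exp (k * x)) := by
    refine Prim.of_hasDerivAt (fun x => ?_) (by fun_prop)
    have h1 : HasDerivAt (fun x : ℝ => k * x) k x := by simpa using (hasDerivAt_id x).const_mul k
    simpa [mul_comm] using h1.exp
  have h1 := (hE.mul (h.mul h)).integral_eq
  have i1 : Integrable (fun x => Real.exp (k * x) * (W x * W x)) unitMeasure :=
    (hE.mul (h.mul h)).memLp_left.integrable one_le_two
  have i2 : Integrable (fun x => Real.exp (k * x) * (w x * W x)) unitMeasure := by
    refine (memLp_mul_continuousOn hE.continuousOn ?_).integrable one_le_two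
    simpa [mul_comm] using memLp_mul_continuousOn h.continuousOn h.memLp
  have h2 : ∀ x, k * Real.exp (k * x) * (W x * W x) +
      Real.exp (k * x) * (w x * W x + W x * w x) =
      k * (Real.exp (k * x) * (W x * W x)) + 2 * (Real.exp (k * x) * (w x * W x)) :=
    fun x => by ring
  simp only [h2] at h1
  rw [integral_add (i1.const_mul k) (i2.const_mul 2), integral_const_mul, integral_const_mul] at h1
  simp only [mul_one, mul_zero, Real.exp_zero, one_mul] at h1
  linarith

/-- The Lyapunov identity in terms of boundary values: `w₁`, `z₁` are the Riemann invariants at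
`x = 1`, `q = ‖p_x‖²`, `Q = ‖p‖²`, and `N` is the weighted wave energy. -/
theorem IsGenerator.energy {a b c d ε : ℝ} (hε : 0 < ε) {Y Z : State}
    (h : IsGenerator a b c d ε Y Z) {m l : ℝ} (hm : 0 ≤ m) (hl : 0 < l) :
    ∃ w₁ z₁ u₁ p₀ p₁ q Q N : ℝ, (1 + a) * w₁ = (1 - a) * z₁ + 2 * b * p₀ ∧
      2 * inner ℝ (riemann m √(l * ε) Z) (riemann m √(l * ε) Y) =
        Real.exp m * w₁ ^ 2 - Real.exp (-m) * z₁ ^ 2 - m * N +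
          2 * l * (d * p₁ * u₁ - c * p₀ ^ 2 - q) ∧
      ‖riemann m √(l * ε) Y‖ ^ 2 = N + l * ε * Q ∧
      2 * Real.exp (-m) * u₁ ^ 2 ≤ N ∧ (p₁ - p₀) ^ 2 ≤ q ∧ Q ≤ 2 * p₀ ^ 2 + 2 * q ∧ 0 ≤ Q := by
  obtain ⟨U, Ux, Uxx, V, Vx, P, Px, Pxx, h⟩ := isGenerator_iff_exists_isProfile.1 h
  have hW := h.primV.add h.primUx
  have hz := h.primV.sub h.primUx
  have hlε : √(l * ε) ^ 2 = l * ε := Real.sq_sqrt (by positivity)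
  have eYw : (Y.v + Y.ux : L2) =ᵐ[unitMeasure] fun x => V x + Ux x := by
    filter_upwards [Lp.coeFn_add Y.v Y.ux, h.v_eq, h.ux_eq] with x e1 e2 e3
    rw [e1, Pi.add_apply, e2, e3]
  have eYz : (Y.v - Y.ux : L2) =ᵐ[unitMeasure] fun x => V x - Ux x := by
    filter_upwards [Lp.coeFn_sub Y.v Y.ux, h.v_eq, h.ux_eq] with x e1 e2 e3
    rw [e1, Pi.sub_apply, e2, e3]
  have eZw : (Z.v + Z.ux : L2) =ᵐ[unitMeasure] fun x => Vx x + Uxx x := by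
    filter_upwards [Lp.coeFn_add Z.v Z.ux, h.zv_eq, h.zux_eq] with x e1 e2 e3
    rw [e1, Pi.add_apply, e2, e3, add_comm]
  have eZz : (Z.v - Z.ux : L2) =ᵐ[unitMeasure] fun x => -(Vx x - Uxx x) := by
    filter_upwards [Lp.coeFn_sub Z.v Z.ux, h.zv_eq, h.zux_eq] with x e1 e2 e3
    rw [e1, Pi.sub_apply, e2, e3, neg_sub]
  have kW := hW.two_mul_integral_exp m
  have kz := hz.two_mul_integral_exp (-m)
  have kP : ∫ x in Ioo (0 : ℝ) 1, Pxx x * P x =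
      P 1 * Px 1 - P 0 * Px 0 - ∫ x in Ioo (0 : ℝ) 1, Px x ^ 2 := by
    have h1 := (h.primP.mul h.primPx).integral_eq
    rw [integral_add (integrable_mul_continuous h.primP.memLp h.primPx.continuousOn)
      ((memLp_mul_continuousOn h.primP.continuousOn h.primPx.memLp).integrable one_le_two)] at h1
    simp only [← sq, mul_comm (P _) (Pxx _)] at h1
    linarith
  have iPx := h.primPx.memLp_left.integrable_sq
  refine ⟨V 1 + Ux 1, V 1 - Ux 1, U 1, P 0, P 1, ∫ x in Ioo (0 : ℝ) 1, Px x ^ 2,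
    ∫ x in Ioo (0 : ℝ) 1, P x ^ 2,
    (∫ x in Ioo (0 : ℝ) 1, Real.exp (m * x) * ((V x + Ux x) * (V x + Ux x))) +
      ∫ x in Ioo (0 : ℝ) 1, Real.exp (-m * x) * ((V x - Ux x) * (V x - Ux x)),
    ?_, ?_, ?_, ?_, ?_, ?_, ?_⟩
  · rw [h.ux_one]; ring
  · rw [inner_riemann, hlε, inner_mulExp m eZw eYw, inner_mulExp (-m) eZz eYz,
      inner_L2_eq h.zp_eq h.p_eq]
    have e1 : ∀ x, Real.exp (-m * x) * (-(Vx x - Uxx x) * (V x - Ux x)) =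
        -(Real.exp (-m * x) * ((Vx x - Uxx x) * (V x - Ux x))) := fun x => by ring
    have e2 : ∀ x, ε⁻¹ * Pxx x * P x = ε⁻¹ * (Pxx x * P x) := fun x => by ring
    simp only [e1, e2]
    rw [integral_neg, integral_const_mul, kP, h.px_zero, h.px_one]
    have e3 : l * ε * (ε⁻¹ * (P 1 * (d * U 1) - P 0 * (c * P 0) -
        ∫ x in Ioo (0 : ℝ) 1, Px x ^ 2)) = l * (d * P 1 * U 1 - c * P 0 ^ 2 -
        ∫ x in Ioo (0 : ℝ) 1, Px x ^ 2) := by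
      field_simp
    rw [e3]
    -- With v(0) = 0 the invariants at 0 are ±u_x(0), so their squares cancel between the two
    -- transport identities.
    rw [h.v_zero] at kW kz
    linarith
  · rw [norm_sq_riemann, hlε, norm_sq_L2_eq h.p_eq, ← real_inner_self_eq_norm_sq,
      ← real_inner_self_eq_norm_sq, inner_mulExp m eYw eYw, inner_mulExp (-m) eYz eYz]
    ring
  · have h1 := h.primU.sq_sub_le zero_mem_unit one_mem_unit
    rw [h.u_zero, sub_zero] at h1
    have c1 : ContinuousOn (fun x => Real.exp (m * x) * ((V x + Ux x) * (V x + Ux x))) (Icc 0 1) :=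
      (by fun_prop : ContinuousOn (fun x : ℝ => Real.exp (m * x)) (Icc 0 1)).mul
        (hW.continuousOn.mul hW.continuousOn)
    have c2 : ContinuousOn (fun x => Real.exp (-m * x) * ((V x - Ux x) * (V x - Ux x))) (Icc 0 1) :=
      (by fun_prop : ContinuousOn (fun x : ℝ => Real.exp (-m * x)) (Icc 0 1)).mul
        (hz.continuousOn.mul hz.continuousOn)
    have i1 := (memLp_of_continuousOn c1).integrable one_le_two
    have i2 := (memLp_of_continuousOn c2).integrable one_le_two
    rw [← integral_add i1 i2]
    refine (mul_le_mul_of_nonneg_left h1 (by positivity)).trans ?_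
    rw [← integral_const_mul]
    refine setIntegral_mono_on (h.primUx.memLp_left.integrable_sq.const_mul _) (i1.add i2)
      measurableSet_Ioo fun x hx => ?_
    -- Both weights are at least e^{-m} on (0,1), and (v + u_x)² + (v - u_x)² ≥ 2u_x².
    have hx0 : Real.exp (-m) ≤ Real.exp (m * x) :=
      Real.exp_le_exp.2 (by nlinarith [hx.1, mul_nonneg hm hx.1.le])
    have hx1 : Real.exp (-m) ≤ Real.exp (-m * x) :=
      Real.exp_le_exp.2 (by nlinarith [hx.2])
    have g1 := mul_le_mul_of_nonneg_right hx0 (mul_self_nonneg (V x + Ux x))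
    have g2 := mul_le_mul_of_nonneg_right hx1 (mul_self_nonneg (V x - Ux x))
    have g3 := mul_nonneg (Real.exp_pos (-m)).le (sq_nonneg (V x))
    nlinarith
  · exact h.primP.sq_sub_le zero_mem_unit one_mem_unit
  · have h1 : ∫ x in Ioo (0 : ℝ) 1, P x ^ 2 ≤
        ∫ _ in Ioo (0 : ℝ) 1, (2 * P 0 ^ 2 + 2 * ∫ s in Ioo (0 : ℝ) 1, Px s ^ 2) := by
      refine setIntegral_mono_on h.primP.memLp_left.integrable_sq (integrable_const _)
        measurableSet_Ioo fun x hx => ?_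
      have h2 := h.primP.sq_sub_le zero_mem_unit (Ioo_subset_Icc_self hx)
      nlinarith [sq_nonneg (P x - 2 * P 0)]
    simpa using h1
  · exact integral_nonneg fun x => sq_nonneg _

/-! ### Explicit solution of the resolvent equations. -/

theorem prim_sinh (k : ℝ) : Prim (fun x => Real.sinh (k * x)) (fun x => k * Real.cosh (k * x)) := by
  refine Prim.of_hasDerivAt (fun x => ?_) (by fun_prop)
  have h1 : HasDerivAt (fun x : ℝ => k * x) k x := by simpa using (hasDerivAt_id x).const_mul k
  simpa [mul_comm] using h1.sinh

theorem prim_cosh (k : ℝ) : Prim (fun x => Real.cosh (k * x)) (fun x => k * Real.sinh (k * x)) := by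
  refine Prim.of_hasDerivAt (fun x => ?_) (by fun_prop)
  have h1 : HasDerivAt (fun x : ℝ => k * x) k x := by simpa using (hasDerivAt_id x).const_mul k
  simpa [mul_comm] using h1.cosh

/-- Variation of constants for `k² y - y'' = g`, `y(0) = y'(0) = 0`. -/
theorem exists_prim_prim_eq {k : ℝ} (hk : 0 < k) {g : ℝ → ℝ} (hg : MemLp g 2 unitMeasure) :
    ∃ y y' : ℝ → ℝ, Prim y y' ∧ Prim y' (fun x => k ^ 2 * y x - g x) ∧ y 0 = 0 ∧ y' 0 = 0 := by
  have hS := Prim.of_integral (memLp_mul_continuousOn (prim_sinh k).continuousOn hg) 0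
  have hC := Prim.of_integral (memLp_mul_continuousOn (prim_cosh k).continuousOn hg) 0
  set S : ℝ → ℝ := fun x => 0 + ∫ s in (0 : ℝ)..x, Real.sinh (k * s) * g s with hSdef
  set C : ℝ → ℝ := fun x => 0 + ∫ s in (0 : ℝ)..x, Real.cosh (k * s) * g s with hCdef
  have hS0 : S 0 = 0 := by simp [hSdef]
  have hC0 : C 0 = 0 := by simp [hCdef]
  refine ⟨fun x => k⁻¹ * (Real.cosh (k * x) * S x - Real.sinh (k * x) * C x),
    fun x => Real.sinh (k * x) * S x - Real.cosh (k * x) * C x, ?_, ?_, by simp [hS0],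
    by simp [hC0]⟩
  · refine ((((prim_cosh k).mul hS).sub ((prim_sinh k).mul hC)).const_mul k⁻¹).congr
      (fun _ _ => rfl) (ae_of_all _ fun x => ?_)
    simp only
    field_simp
    ring
  · refine (((prim_sinh k).mul hS).sub ((prim_cosh k).mul hC)).congr
      (fun _ _ => rfl) (ae_of_all _ fun x => ?_)
    simp only
    have h1 := Real.cosh_sq (k * x)
    field_simp
    linear_combination (-(g x)) * h1

theorem exists_solve_two {A B C D : ℝ} (h : A * C - B * D ≠ 0) (r₁ r₂ : ℝ) :
    ∃ x y : ℝ, A * x - B * y = r₁ ∧ C * y - D * x = r₂ := by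
  refine ⟨(C * r₁ + B * r₂) / (A * C - B * D), (A * r₂ + D * r₁) / (A * C - B * D), ?_, ?_⟩ <;>
  · rw [mul_div_assoc', mul_div_assoc', ← sub_div, div_eq_iff h]
    ring

/-- `s - A_ε` is onto the phase space for `s > 1`. -/
theorem exists_isGenerator_resolvent {a b c d ε s : ℝ} (ha : 0 ≤ a) (hc : 0 < c)
    (hbd : |b * d| ≤ c) (hε : 0 < ε) (hs : 1 < s) (F : Phase) :
    ∃ Y Z : Phase, IsGenerator a b c d ε Y Z ∧ s • Y - Z = F := by
  obtain ⟨Φ, hΦ, hΦe⟩ := hasWeakDeriv_iff.1 F.1.hasWeakDeriv_u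
  have hΦ0 : Φ 0 = 0 := (traceZero_eq hΦ hΦe (ae_eq_refl _)).symm.trans F.2
  set k := √(s * ε) with hk
  have hsε : 0 < s * ε := by positivity
  have hkpos : 0 < k := Real.sqrt_pos.2 hsε
  have hk2 : k ^ 2 = s * ε := Real.sq_sqrt hsε.le
  obtain ⟨y, y', hy, hy', hy0, hy'0⟩ := exists_prim_prim_eq (zero_lt_one.trans hs)
    ((Lp.memLp F.1.v).add (hΦ.memLp_left.const_mul s))
  obtain ⟨π, π', hπ, hπ', hπ0, hπ'0⟩ := exists_prim_prim_eq hkpos ((Lp.memLp F.1.p).const_mul ε)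
  -- Determinant of the two boundary conditions at x = 1. It is positive: sinh s < s cosh s since s
  -- > 1, the heat factor exceeds c, and bd ≤ c.
  have hdet : (s * (Real.cosh s + a * Real.sinh s)) * (k * (k * Real.sinh k + c * Real.cosh k)) -
      (b * k) * (d * Real.sinh s) ≠ 0 := by
    have h1 : 0 < Real.sinh s := Real.sinh_pos_iff.2 (by linarith)
    have h2 : 0 < Real.sinh k := Real.sinh_pos_iff.2 hkpos
    have h3 : 1 ≤ Real.cosh k := Real.one_le_cosh k
    have h4 : Real.sinh s < Real.cosh s := Real.sinh_lt_cosh s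
    have h5 : Real.sinh s < s * (Real.cosh s + a * Real.sinh s) := by
      nlinarith [mul_nonneg ha h1.le]
    have h6 : c < k * Real.sinh k + c * Real.cosh k := by nlinarith [mul_pos hkpos h2]
    have h7 : Real.sinh s * c < s * (Real.cosh s + a * Real.sinh s) *
        (k * Real.sinh k + c * Real.cosh k) := mul_lt_mul'' h5 h6 h1.le hc.le
    have h8 : b * d * Real.sinh s ≤ c * Real.sinh s :=
      mul_le_mul_of_nonneg_right ((le_abs_self _).trans hbd) h1.le
    have h9 : 0 < k * (s * (Real.cosh s + a * Real.sinh s) *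
        (k * Real.sinh k + c * Real.cosh k) - b * d * Real.sinh s) :=
      mul_pos hkpos (by linarith)
    refine ne_of_gt (lt_of_lt_of_eq h9 (by ring))
  -- The particular solutions y, π vanish to first order at 0. Adding β sinh(sx) and α(k cosh(kx) +
  -- c sinh(kx)) keeps u(0) = 0 and p_x(0) = c p(0), leaving β, α for the conditions at 1.
  obtain ⟨β, α, e1, e2⟩ := exists_solve_two hdet (-y' 1 - a * s * y 1 + a * Φ 1)
    (d * y 1 - π' 1)
  have hU := hy.add ((prim_sinh s).const_mul β)
  have hUx := hy'.add (((prim_cosh s).const_mul s).const_mul β)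
  have hP := hπ.add ((((prim_cosh k).const_mul k).add ((prim_sinh k).const_mul c)).const_mul α)
  have hPx := hπ'.add (((((prim_sinh k).const_mul k).const_mul k).add
    (((prim_cosh k).const_mul k).const_mul c)).const_mul α)
  have hV := (hU.const_mul s).sub hΦ
  obtain ⟨Y, Yu, Yux, Yv, Yp⟩ := exists_state hU hV.memLp_left hP.memLp_left
  obtain ⟨Z, Zu, Zux, Zv, Zp⟩ := exists_state hV hUx.memLp (hPx.memLp.const_mul ε⁻¹)
  have hprof : IsProfile a b c d ε Y Z _ _ _ _ _ _ _ _ :=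
    { primU := hU
      primUx := hUx
      primV := hV
      primP := hP
      primPx := hPx
      u_zero := by simp [hy0]
      v_zero := by simp [hy0, hΦ0]
      ux_one := by
        simp only [mul_one, mul_zero, Real.sinh_zero, Real.cosh_zero, hπ0]
        linear_combination e1
      px_zero := by simp [hπ0, hπ'0]; ring
      px_one := by
        simp only [mul_one]
        linear_combination e2
      u_eq := Yu
      ux_eq := Yux
      v_eq := Yv
      p_eq := Yp
      zu_eq := Zu
      zux_eq := Zux
      zv_eq := Zv
      zp_eq := Zp }
  refine ⟨⟨Y, hprof.mem_phase.1⟩, ⟨Z, hprof.mem_phase.2⟩,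
    isGenerator_iff_exists_isProfile.2 ⟨_, _, _, _, _, _, _, _, hprof⟩, Subtype.ext ?_⟩
  have key : ∀ {f f' f'' : L2} {G G' : ℝ → ℝ}, f =ᵐ[unitMeasure] G → f' =ᵐ[unitMeasure] G' →
      (f'' =ᵐ[unitMeasure] fun x => s * G x - G' x) → s • f - f' = f'' := by
    intro f f' f'' G G' h1 h2 h3
    refine Lp.ext ?_
    filter_upwards [Lp.coeFn_sub (s • f) f', Lp.coeFn_smul s f, h1, h2, h3] with x i1 i2 i3 i4 i5
    rw [i1, Pi.sub_apply, i2, Pi.smul_apply, i3, i4, i5, smul_eq_mul]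
  refine State.ext_components (Y := s • Y - Z) (key Yu Zu ?_) (key Yv Zv ?_) (key Yp Zp ?_)
  · filter_upwards [hΦe] with x hx
    rw [hx]
    ring
  · filter_upwards with x
    simp only [Pi.add_apply]
    ring
  · filter_upwards with x
    have h1 : ε⁻¹ * k ^ 2 = s := by rw [hk2]; field_simp
    have h2 : ε⁻¹ * ε = 1 := inv_mul_cancel₀ hε.ne'
    linear_combination (π x + α * (k * Real.cosh (k * x) + c * Real.sinh (k * x))) * h1 -
      F.1.p x * h2

/-! ### Mild solutions in the state space and in the phase space. -/

theorem isMildSolution_of_isMild {a b c d ε : ℝ} {x₀ : Phase} {y : ℝ → Phase}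
    (h : IsMild (generator a b c d ε) x₀ y) :
    IsMildSolution a b c d ε x₀ (fun t => (y t : State)) := by
  refine ⟨continuous_subtype_val.comp_continuousOn h.1, fun t ht => ?_⟩
  have h1 := mem_generator.1 (h.2 t ht)
  have h2 : ∫ s in (0 : ℝ)..t, (y s : State) = ((∫ s in (0 : ℝ)..t, y s : Phase) : State) :=
    Phase.subtypeL.intervalIntegral_comp_comm
      (h.1.mono (by rw [uIcc_of_le ht]; exact Icc_subset_Ici_self)).intervalIntegrable
  rw [h2]
  exact h1

theorem IsMildSolution.exists_isMild {a b c d ε : ℝ} {Y₀ : State} {Y : ℝ → State}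
    (h₀ : Y₀ ∈ Phase) (h : IsMildSolution a b c d ε Y₀ Y) :
    ∃ y : ℝ → Phase, IsMild (generator a b c d ε) ⟨Y₀, h₀⟩ y ∧
      ∀ t, 0 ≤ t → (y t : State) = Y t := by
  have hmem : ∀ t, 0 ≤ t → Y t ∈ Phase := by
    intro t ht
    obtain ⟨_, _, _, _, _, _, _, _, hp⟩ := isGenerator_iff_exists_isProfile.1 (h.2 t ht)
    simpa using Phase.add_mem hp.mem_phase.2 h₀
  -- Y is unconstrained for t < 0; freezing it there gives a continuous function with values in the
  -- phase space.
  set y : ℝ → Phase := fun t => ⟨Y (max t 0), hmem _ (le_max_right _ _)⟩ with hy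
  have hyt : ∀ t, 0 ≤ t → (y t : State) = Y t := fun t ht => by simp [hy, max_eq_left ht]
  have hcont : Continuous y := by
    refine Continuous.subtype_mk ?_ _
    exact h.1.comp_continuous (by fun_prop) fun t => mem_Ici.2 (le_max_right t 0)
  refine ⟨y, ⟨hcont.continuousOn, fun t ht => mem_generator.2 ?_⟩, hyt⟩
  have h2 : ∫ s in (0 : ℝ)..t, (y s : State) = ((∫ s in (0 : ℝ)..t, y s : Phase) : State) :=
    Phase.subtypeL.intervalIntegral_comp_comm (hcont.intervalIntegrable _ _)
  have h3 : ∫ s in (0 : ℝ)..t, (y s : State) = ∫ s in (0 : ℝ)..t, Y s :=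
    intervalIntegral.integral_congr fun s hs => hyt s (by
      rw [uIcc_of_le ht] at hs
      exact hs.1)
  have h4 := h.2 t ht
  rw [← h3, h2, ← hyt t ht] at h4
  exact h4

/-- Well-posedness, with growth rate given by the dissipativity constant in the weighted Riemann
coordinates. -/
theorem exists_isMildSolution_of_dissipative {a b c d ε m r γ : ℝ} (ha : 0 ≤ a) (hc : 0 < c)
    (hbd : |b * d| ≤ c) (hε : 0 < ε) (hr : 0 < r)
    (hdiss : ∀ Y Z : State, IsGenerator a b c d ε Y Z →
      inner ℝ (riemann m r Z) (riemann m r Y) ≤ γ * ‖riemann m r Y‖ ^ 2) :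
    ∃ C : ℝ, 0 < C ∧ ∀ Y₀ : State, HasTrace Y₀.u 0 0 → ∃ Y : ℝ → State,
      IsMildSolution a b c d ε Y₀ Y ∧
      (∀ Y', IsMildSolution a b c d ε Y₀ Y' → EqOn Y' Y (Ici 0)) ∧
      ∀ t, 0 ≤ t → ‖Y t‖ ≤ C * Real.exp (γ * t) * ‖Y₀‖ := by
  let T : Phase →L[ℝ] RiemannSpace := riemann m r ∘L Phase.subtypeL
  obtain ⟨N, hN, hb⟩ := exists_norm_le_riemann m hr
  have hdiss' : ∀ x y, (x, y) ∈ generator a b c d ε → inner ℝ (T y) (T x) ≤ γ * ‖T x‖ ^ 2 :=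
    fun x y hxy => hdiss x y hxy
  have hsv : ∀ y, (0, y) ∈ generator a b c d ε → y = 0 :=
    fun y hy => Subtype.ext (IsGenerator.eq_zero hy)
  have hrange : ∀ s : ℝ, 1 < s → ∀ f, ∃ x y, (x, y) ∈ generator a b c d ε ∧ s • x - y = f :=
    fun s hs f => exists_isGenerator_resolvent ha hc hbd hε hs f
  obtain ⟨C, hC, h⟩ := exists_isMild_of_bounded_below T hN (fun x => hb x.1 x.2) hdiss' hsv hrange
  refine ⟨C, hC, fun Y₀ h₀ => ?_⟩
  obtain ⟨y, hy, huniq, hbound⟩ := h ⟨Y₀, mem_phase_iff.2 h₀⟩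
  have hsol := isMildSolution_of_isMild hy
  refine ⟨fun t => y t, hsol, fun Y' hY' t ht => ?_,
    fun t ht => ?_⟩
  · obtain ⟨z, hz, hzt⟩ := hY'.exists_isMild (mem_phase_iff.2 h₀)
    rw [← hzt t ht, huniq z hz ht]
  · have hb := hbound t ht
    rwa [Phase.norm_eq, Phase.norm_eq] at hb

/-! ### Dissipativity estimates. -/

/-- Square the boundary relation with (x + y)² ≤ 2x² + 2y². This is the source of the 2 in the
condition on m, which lets e^{-m}z² absorb the reflected part. -/
theorem boundary_energy_le {a b m w z p : ℝ} (ha : 0 < 1 + a)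
    (hm : 2 * Real.exp (2 * m) * (1 - a) ^ 2 ≤ (1 + a) ^ 2)
    (h : (1 + a) * w = (1 - a) * z + 2 * b * p) :
    Real.exp m * w ^ 2 - Real.exp (-m) * z ^ 2 ≤ 8 * Real.exp m * b ^ 2 / (1 + a) ^ 2 * p ^ 2 := by
  have he := Real.exp_pos m
  have he' := Real.exp_pos (-m)
  have hee : Real.exp (-m) * Real.exp (2 * m) = Real.exp m := by
    rw [← Real.exp_add]; ring_nf
  have h1 : 2 * Real.exp m * (1 - a) ^ 2 ≤ Real.exp (-m) * (1 + a) ^ 2 := by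
    have := mul_le_mul_of_nonneg_left hm he'.le
    calc 2 * Real.exp m * (1 - a) ^ 2 = Real.exp (-m) * (2 * Real.exp (2 * m) * (1 - a) ^ 2) := by
          rw [← hee]; ring
      _ ≤ _ := this
  have h2 : ((1 + a) * w) ^ 2 ≤ 2 * (1 - a) ^ 2 * z ^ 2 + 8 * b ^ 2 * p ^ 2 := by
    rw [h]
    nlinarith [sq_nonneg ((1 - a) * z - 2 * b * p)]
  have h3 := mul_le_mul_of_nonneg_left h2 he.le
  have h4 := mul_le_mul_of_nonneg_right h1 (sq_nonneg z)
  rw [div_mul_eq_mul_div, le_div_iff₀ (by positivity)]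
  nlinarith

theorem sq_le_two_mul_add {x y q : ℝ} (h : (y - x) ^ 2 ≤ q) : y ^ 2 ≤ 2 * x ^ 2 + 2 * q := by
  linarith [sq_nonneg (y - 2 * x), h, sub_sq y x, sub_sq y (2 * x), mul_pow 2 x 2]

theorem exists_quasiDissipative {a b c d : ℝ} (ha : 0 < a)
    (ha3 : 3 * (1 - a) ^ 2 ≤ (1 + a) ^ 2) (hc : 1 ≤ c) :
    ∃ l γ : ℝ, 0 < l ∧ ∀ ε : ℝ, 0 < ε → ∀ Y Z : State, IsGenerator a b c d ε Y Z →
      inner ℝ (riemann 0 √(l * ε) Z) (riemann 0 √(l * ε) Y) ≤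
        γ * ‖riemann 0 √(l * ε) Y‖ ^ 2 := by
  set K : ℝ := 8 * Real.exp 0 * b ^ 2 / (1 + a) ^ 2 with hK
  have hK0 : 0 ≤ K := by positivity
  -- The weight K + 1 on the heat energy leaves enough of the damping c p₀² to absorb the boundary
  -- term K p₀².
  refine ⟨K + 1, (K + 1) * d ^ 2, by positivity, fun ε hε Y Z h => ?_⟩
  obtain ⟨w, z, u, p₀, p₁, q, Q, N, e1, e2, e3, e4, e5, e6, e7⟩ :=
    h.energy hε (m := 0) (l := K + 1) le_rfl (by positivity)
  have hb := boundary_energy_le (m := 0) (by linarith)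
    (by rw [mul_zero, Real.exp_zero]; nlinarith [sq_nonneg (1 - a)]) e1
  rw [← hK] at hb
  simp only [neg_zero, Real.exp_zero, mul_one] at e4
  have hQ : 0 ≤ (K + 1) * ε * Q := by positivity
  have hdp : d * p₁ * u ≤ p₀ ^ 2 / 2 + q / 2 + d ^ 2 * u ^ 2 := by
    linarith [sq_nonneg (p₁ / 2 - d * u), sq_le_two_mul_add e5,
      (by ring : (p₁ / 2 - d * u) ^ 2 = p₁ ^ 2 / 4 - d * p₁ * u + d ^ 2 * u ^ 2)]
  have hcp : p₀ ^ 2 ≤ c * p₀ ^ 2 := le_mul_of_one_le_left (sq_nonneg _) hc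
  have hq : 0 ≤ q := (sq_nonneg _).trans e5
  have h1 : (K + 1) * (d * p₁ * u - c * p₀ ^ 2 - q) ≤
      (K + 1) * (-(p₀ ^ 2 / 2) + d ^ 2 * u ^ 2) :=
    mul_le_mul_of_nonneg_left (by linarith) (by positivity)
  have h2 : (K + 1) * d ^ 2 * (2 * u ^ 2) ≤ (K + 1) * d ^ 2 * (N + (K + 1) * ε * Q) :=
    mul_le_mul_of_nonneg_left (by linarith) (by positivity)
  have h3 : 0 ≤ (K + 1) * d ^ 2 * (N + (K + 1) * ε * Q) := le_trans (by positivity) h2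
  rw [e3]
  nlinarith [sq_nonneg p₀]

/-- The heat energy lεQ is damped at rate δ/ε and the wave energy at rate δ; the slower of the two
governs the sum. -/
theorem neg_le_of_decay {δ l ε N Q I : ℝ} (hδ : 0 < δ) (hl : 0 < l) (hε : 0 < ε) (hN : 0 ≤ N)
    (hQ : 0 ≤ Q) (h : 2 * I ≤ -(δ * N) - δ * (l * Q)) :
    I ≤ -(δ / 2 * min 1 ε⁻¹) * (N + l * ε * Q) := by
  have h1 : min 1 ε⁻¹ * N ≤ N := mul_le_of_le_one_left hN (min_le_left _ _)
  have h2 : min 1 ε⁻¹ * (l * ε * Q) ≤ l * Q := by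
    refine (mul_le_mul_of_nonneg_right (min_le_right 1 ε⁻¹) (by positivity)).trans (le_of_eq ?_)
    field_simp
  have h3 := mul_le_mul_of_nonneg_left (add_le_add h1 h2) hδ.le
  nlinarith

theorem exists_dissipative {a b c d μ : ℝ} (ha : 0 < a) (ha3 : 3 * (1 - a) ^ 2 ≤ (1 + a) ^ 2)
    (ha8 : 8 / 5 ≤ (1 + a) ^ 2) (hμ0 : 0 ≤ μ)
    (hμ : 2 * Real.exp (2 * μ) * (1 - a) ^ 2 ≤ (1 + a) ^ 2)
    (hbc : 1 + 3 * Real.exp μ * b ^ 2 ≤ c) (hc : 2 ≤ c) (hd : d ^ 2 ≤ μ * Real.exp (-μ)) :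
    ∃ m l κ : ℝ, 0 < l ∧ 0 < κ ∧ ∀ ε : ℝ, 0 < ε → ∀ Y Z : State, IsGenerator a b c d ε Y Z →
      inner ℝ (riemann m √(l * ε) Z) (riemann m √(l * ε) Y) ≤
        -(κ * min 1 ε⁻¹) * ‖riemann m √(l * ε) Y‖ ^ 2 := by
  rcases hμ0.eq_or_lt with h0 | hpos
  · have hd0 : d = 0 := by
      rw [← h0, zero_mul] at hd
      exact pow_eq_zero_iff two_ne_zero |>.1 (le_antisymm hd (sq_nonneg d))
    set K : ℝ := 8 * Real.exp (1 / 10) * b ^ 2 / (1 + a) ^ 2 with hK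
    have hK0 : 0 ≤ K := by positivity
    -- The weight m = μ = 0 would give no wave decay. The exponent 1/10 is small enough that 2e^{2m}
    -- ≤ 3, so the range of a alone suffices at the boundary.
    refine ⟨1 / 10, K + 1, 1 / 10 / 2, by positivity, by norm_num, fun ε hε Y Z h => ?_⟩
    obtain ⟨w, z, u, p₀, p₁, q, Q, N, e1, e2, e3, e4, e5, e6, e7⟩ :=
      h.energy hε (m := 1 / 10) (l := K + 1) (by norm_num) (by positivity)
    have hexp : Real.exp (2 * (1 / 10)) ≤ 3 / 2 := by
      have h1 := Real.exp_bound_div_one_sub_of_interval (x := 2 * (1 / 10)) (by norm_num)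
        (by norm_num)
      norm_num at h1 ⊢
      linarith
    have hb := boundary_energy_le (m := 1 / 10) (by linarith)
      (by nlinarith [sq_nonneg (1 - a)]) e1
    rw [← hK] at hb
    have hN : 0 ≤ N := le_trans (by positivity) e4
    have hq : 0 ≤ q := (sq_nonneg _).trans e5
    rw [e3]
    refine neg_le_of_decay (by norm_num) (by positivity) hε hN e7 ?_
    rw [e2, hd0]
    have hcp : 2 * p₀ ^ 2 ≤ c * p₀ ^ 2 := mul_le_mul_of_nonneg_right hc (sq_nonneg _)
    have h1 : (K + 1) * (0 * p₁ * u - c * p₀ ^ 2 - q) ≤ (K + 1) * (-(2 * p₀ ^ 2) - q) :=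
      mul_le_mul_of_nonneg_left (by linarith) (by positivity)
    have h2 : (K + 1) * Q ≤ (K + 1) * (2 * p₀ ^ 2 + 2 * q) :=
      mul_le_mul_of_nonneg_left e6 (by positivity)
    have h3 : 0 ≤ (K + 1) * q := by positivity
    have h4 : 0 ≤ (K + 1) * p₀ ^ 2 := by positivity
    nlinarith [sq_nonneg p₀]
  · set K : ℝ := 8 * Real.exp μ * b ^ 2 / (1 + a) ^ 2 with hK
    have hKc : K ≤ 5 / 3 * (c - 1) := by
      have h1 : K ≤ 5 * (Real.exp μ * b ^ 2) := by
        rw [hK, div_le_iff₀ (by positivity)]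
        have : 0 ≤ Real.exp μ * b ^ 2 := by positivity
        nlinarith
      linarith
    -- What the Young inequality below leaves: μ/4 of the wave damping, and 2/3 of ‖p_x‖² together
    -- with at least p₀², which dominate Q/3.
    set δ := min (μ / 4) (1 / 3) with hδ
    have hδpos : 0 < δ := lt_min (by linarith) (by norm_num)
    refine ⟨μ, 1, δ / 2, one_pos, by positivity, fun ε hε Y Z h => ?_⟩
    obtain ⟨w, z, u, p₀, p₁, q, Q, N, e1, e2, e3, e4, e5, e6, e7⟩ :=
      h.energy hε (m := μ) (l := 1) hμ0 one_pos
    have hb := boundary_energy_le (by linarith) hμ e1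
    rw [← hK] at hb
    have hN : 0 ≤ N := le_trans (by positivity) e4
    have hq : 0 ≤ q := (sq_nonneg _).trans e5
    rw [e3]
    refine neg_le_of_decay hδpos one_pos hε hN e7 ?_
    rw [e2]
    -- With d²u² ≤ μN/2 the first term uses 3/4 of μN; with p₁² ≤ 2p₀² + 2q the second uses 4/3 of
    -- the available 2q.
    have hdp : 2 * (d * p₁ * u) ≤ 3 / 2 * (d ^ 2 * u ^ 2) + 2 / 3 * p₁ ^ 2 := by
      linarith [sq_nonneg (3 * (d * u) - 2 * p₁),
        (by ring : (3 * (d * u) - 2 * p₁) ^ 2 =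
          9 * (d ^ 2 * u ^ 2) - 12 * (d * p₁ * u) + 4 * p₁ ^ 2)]
    have hp1 : p₁ ^ 2 ≤ 2 * p₀ ^ 2 + 2 * q := sq_le_two_mul_add e5
    have hdu : d ^ 2 * u ^ 2 ≤ μ * (N / 2) := by
      refine (mul_le_mul_of_nonneg_right hd (sq_nonneg u)).trans ?_
      rw [mul_assoc]
      exact mul_le_mul_of_nonneg_left (by linarith) hμ0
    have hKp : K * p₀ ^ 2 ≤ 5 / 3 * (c - 1) * p₀ ^ 2 :=
      mul_le_mul_of_nonneg_right hKc (sq_nonneg _)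
    have hcp : 2 * p₀ ^ 2 ≤ c * p₀ ^ 2 := mul_le_mul_of_nonneg_right hc (sq_nonneg _)
    have hδN : δ * N ≤ μ / 4 * N := mul_le_mul_of_nonneg_right (min_le_left _ _) hN
    have hδQ : δ * (1 * Q) ≤ 1 / 3 * Q := by
      rw [one_mul]
      exact mul_le_mul_of_nonneg_right (min_le_right _ _) e7
    linarith [sq_nonneg p₀]

end WaveHeat

end

/-! ### The theorem: reduction of its hypotheses to the inequalities used above. -/

open WaveHeat in
theorem theorem1 (a b c d μ η : ℝ)
    (hη : η = (√3 + 1) / (√3 - 1))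
    (ha : a ∈ Set.Icc η⁻¹ η) (ha1 : a ≠ 1)
    (hbdc : |b * d / c| ≤ 1)
    (hc : Real.pi ^ 2 / 8 ≤ c)
    (hμ0 : 0 ≤ μ) (hμ : μ ≤ Real.log (|1 + a| / (√2 * |1 - a|)))
    (hbc : 1 + 2 * (Real.sinh μ + 2 * Real.cosh μ) * b ^ 2 ≤ c)
    (hd : |d| ≤ 2 * √(μ * Real.exp (-μ))) :
    (∀ ε : ℝ, 0 < ε → ∀ Y₀ : State, HasTrace Y₀.u 0 0 →
      ∃ Y : ℝ → State, IsMildSolution a b c d ε Y₀ Y ∧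
        ∀ Y' : ℝ → State, IsMildSolution a b c d ε Y₀ Y' → Set.EqOn Y' Y (Set.Ici 0)) ∧
    (Real.pi ^ 2 / 4 ≤ c → |d| ≤ √(μ * Real.exp (-μ)) →
      ∃ κ : ℝ, 0 < κ ∧ ∀ ε : ℝ, 0 < ε → ∃ C : ℝ, 0 < C ∧
        ∀ (Y₀ : State) (Y : ℝ → State), HasTrace Y₀.u 0 0 →
          IsMildSolution a b c d ε Y₀ Y →
            ∀ t : ℝ, 0 ≤ t → ‖Y t‖ ≤ C * Real.exp (-(κ * min 1 ε⁻¹) * t) * ‖Y₀‖) := by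
  have h3 : √3 ^ 2 = 3 := Real.sq_sqrt (by norm_num)
  have h3lt : √3 < 1.7321 := by
    rw [Real.sqrt_lt' (by norm_num)]; norm_num
  have h3gt : 1.732 < √3 := by
    rw [Real.lt_sqrt (by norm_num)]; norm_num
  have hηe : η = 2 + √3 := by
    rw [hη, div_eq_iff (by linarith)]
    linear_combination -h3
  have hηi : η⁻¹ = 2 - √3 := by
    rw [hηe]
    refine inv_eq_of_mul_eq_one_right ?_
    linear_combination -h3
  obtain ⟨hal, hau⟩ := ha
  rw [hηi] at hal
  rw [hηe] at hau
  have ha0 : 0 < a := by linarith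
  -- Equivalent to a² - 4a + 1 ≤ 0, whose roots are 2 ± √3, that is, η⁻¹ and η.
  have ha3 : 3 * (1 - a) ^ 2 ≤ (1 + a) ^ 2 := by
    nlinarith [mul_nonneg (sub_nonneg.2 hal) (sub_nonneg.2 hau)]
  have ha8 : 8 / 5 ≤ (1 + a) ^ 2 := by nlinarith
  have hπ := Real.pi_gt_three
  have hc1 : 1 ≤ c := by nlinarith
  have hc0 : 0 < c := by linarith
  have hbd : |b * d| ≤ c := by
    rwa [abs_div, abs_of_pos hc0, div_le_one hc0] at hbdc
  constructor
  · obtain ⟨l, γ, hl, hdiss⟩ := exists_quasiDissipative (b := b) (d := d) ha0 ha3 hc1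
    intro ε hε Y₀ h₀
    obtain ⟨C, -, h⟩ := exists_isMildSolution_of_dissipative ha0.le hc0 hbd hε
      (Real.sqrt_pos.2 (mul_pos hl hε)) (hdiss ε hε)
    obtain ⟨Y, hY, huniq, -⟩ := h Y₀ h₀
    exact ⟨Y, hY, huniq⟩
  · intro hc4 hd1
    have hμ2 : 2 * Real.exp (2 * μ) * (1 - a) ^ 2 ≤ (1 + a) ^ 2 := by
      have h1a : 0 < |1 - a| := abs_pos.2 (sub_ne_zero.2 ha1.symm)
      have h2 : 0 < √2 * |1 - a| := by positivity
      have h1a' : 0 < |1 + a| := abs_pos.2 (by linarith)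
      rw [Real.le_log_iff_exp_le (by positivity), le_div_iff₀ h2] at hμ
      have h4 := pow_le_pow_left₀ (by positivity) hμ 2
      rw [mul_pow, mul_pow, sq_abs, sq_abs, Real.sq_sqrt zero_le_two, ← Real.exp_nat_mul] at h4
      push_cast at h4
      linarith
    -- Here 2(sinh μ + 2cosh μ) = 3e^μ + e^{-μ}, and the last term is dropped.
    have hbc' : 1 + 3 * Real.exp μ * b ^ 2 ≤ c := by
      rw [Real.sinh_eq, Real.cosh_eq] at hbc
      nlinarith [mul_nonneg (Real.exp_pos (-μ)).le (sq_nonneg b)]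
    have hd2 : d ^ 2 ≤ μ * Real.exp (-μ) := by
      have h5 := pow_le_pow_left₀ (abs_nonneg d) hd1 2
      rwa [sq_abs, Real.sq_sqrt (by positivity)] at h5
    obtain ⟨m, l, κ, hl, hκ, hdiss⟩ := exists_dissipative ha0 ha3 ha8 hμ0 hμ2 hbc'
      (by nlinarith) hd2
    refine ⟨κ, hκ, fun ε hε => ?_⟩
    obtain ⟨C, hC, h⟩ := exists_isMildSolution_of_dissipative ha0.le hc0 hbd hε
      (Real.sqrt_pos.2 (mul_pos hl hε)) (hdiss ε hε)
    refine ⟨C, hC, fun Y₀ Y h₀ hY t ht => ?_⟩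
    obtain ⟨Y', -, huniq, hb⟩ := h Y₀ h₀
    rw [huniq Y hY ht]
    exact hb t ht
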